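/- Let $D^2=\{x\in\mathbb R^2:|x|<1\}$ and $\mathbb S^1=\partial D^2$, both seen in $\mathbb R^2=\mathbb C$. For a measurable function $f$ on $D^2$ put $$\|f\|_{L^{(2,\infty)}(D^2)}:=\Big(\sup_{\lambda>0}\lambda^2\,\big|\{x\in D^2:|f(x)|>\lambda\}\big|\Big)^{1/2}.$$ Let $W^{1,1}(\mathbb S^1,\mathbb S^1)$ be the set of maps $\phi:\mathbb S^1\to\mathbb S^1$ that, as $\mathbb C$-valued functions, have a weak derivative $\phi'\in L^1(\mathbb S^1)$ with respect to arc length, with $\|\phi\|_{W^{1,1}}:=\|\phi\|_{L^1(\mathbb S^1)}+\|\phi'\|_{L^1(\mathbb S^1)}$. Let $W^{1,(2,\infty)}(D^2,\mathbb S^1)$ be the set of maps $u:D^2\to\mathbb S^1$ that, as $\mathbb C$-valued functions, have a weak gradient $\nabla u$ on $D^2$ with $\|u\|_{W^{1,(2,\infty)}}:=\|u\|_{L^{(2,\infty)}(D^2)}+\|\nabla u\|_{L^{(2,\infty)}(D^2)}<\infty$. **Theorem.** There exists a function $g:[0,\infty)\to[0,\infty)$ with the following property. For every $\phi\in W^{1,1}(\mathbb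 S^1,\mathbb S^1)$ there exists $u\in W^{1,(2,\infty)}(D^2,\mathbb S^1)$ such that $u|_{\partial D^2}=\phi$ in the sense of traces and $$\|u\|_{W^{1,(2,\infty)}(D^2,\mathbb S^1)}\le g\big(\|\phi\|_{W^{1,1}(\mathbb S^1,\mathbb S^1)}\big).$$ Here $u|_{\partial D^2}=\phi$ in the sense of traces means that $\phi$ is the image of $u$ under the continuous trace operator $W^{1,1}(D^2)\to L^1(\mathbb S^1)$, i.e. there are $w_k\in C^\infty(\mathbb R^2,\mathbb C)$ with $w_k\to u$ in $W^{1,1}(D^2)$ and $w_k|_{\mathbb S^1}\to\phi$ in $L^1(\mathbb S^1)$. -/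

import Mathlib

open MeasureTheory Set Filter Topology
open scoped ENNReal NNReal ContDiff

noncomputable section

namespace CircleExtension

/-- The weak-`L^p` (Lorentz `L^{(p,∞)}`) quasinorm
`(sup_{t > 0} t ^ p * μ {x | |f x| > t}) ^ (1 / p)`. -/
def weakLpNorm {α F : Type*} [MeasurableSpace α] [NormedAddCommGroup F]
    (f : α → F) (p : ℝ) (μ : Measure α) : ℝ≥0∞ :=
  (⨆ (t : ℝ≥0) (_ : 0 < t), (t : ℝ≥0∞) ^ p * μ {x | (t : ℝ≥0∞) < ‖f x‖ₑ}) ^ (1 / p)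

/-! ### The boundary circle -/

instance circleMeasurableSpace : MeasurableSpace Circle := borel Circle

instance circleBorelSpace : BorelSpace Circle := ⟨rfl⟩

/-- Arc length on the unit circle (total mass `2π`). -/
def arcLength : Measure Circle :=
  (volume.restrict (Ioc (-Real.pi) Real.pi)).map Circle.exp

/-- The derivative `d/dt η (z e^{it})` at `t = 0`, i.e. the derivative of `η` with respect to
arc length (counterclockwise). -/
def angularDeriv (η : Circle → ℝ) (z : Circle) : ℝ :=
  deriv (fun t : ℝ => η (z * Circle.exp t)) 0

/-- `φ' : 𝕊¹ → ℂ` is the weak arc-length derivative of `φ : 𝕊¹ → ℂ`; both are `L¹`.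
The test functions are the smooth real functions on `𝕊¹`. -/
structure HasWeakAngularDeriv (φ φ' : Circle → ℂ) : Prop where
  integrable : Integrable φ arcLength
  integrable_deriv : Integrable φ' arcLength
  integral_eq : ∀ η : Circle → ℝ, ContDiff ℝ ∞ (fun t : ℝ => η (Circle.exp t)) →
    ∫ z, angularDeriv η z • φ z ∂arcLength = -∫ z, η z • φ' z ∂arcLength

/-- The `W^{1,1}(𝕊¹)` norm `‖φ‖_{L¹} + ‖φ'‖_{L¹}`. The weak derivative `φ'` is unique up to null
sets, so the infimum is over a single value; it is `∞` when there is no weak derivative. -/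
def normW11 (φ : Circle → ℂ) : ℝ≥0∞ :=
  ⨅ (φ' : Circle → ℂ) (_ : HasWeakAngularDeriv φ φ'),
    eLpNorm φ 1 arcLength + eLpNorm φ' 1 arcLength

/-- `φ ∈ W^{1,1}(𝕊¹, 𝕊¹)`, where the target is the unit circle in `ℂ`. -/
def MemW11 (φ : Circle → Circle) : Prop :=
  normW11 (fun z => (φ z : ℂ)) < ⊤

/-! ### The disc -/

/-- The open unit disc `D²`. -/
def disc : Set ℂ := Metric.ball 0 1

/-- `Du` is the weak (real) differential of `u : Ω → ℂ` on the open set `Ω ⊆ ℂ = ℝ²`; only the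
values on `Ω` matter. -/
structure HasWeakFDeriv (Ω : Set ℂ) (u : ℂ → ℂ) (Du : ℂ → ℂ →L[ℝ] ℂ) : Prop where
  locallyIntegrable : LocallyIntegrableOn u Ω volume
  locallyIntegrable_fderiv : LocallyIntegrableOn Du Ω volume
  integral_eq : ∀ η : ℂ → ℝ, ContDiff ℝ ∞ η → HasCompactSupport η → tsupport η ⊆ Ω → ∀ v : ℂ,
    ∫ x in Ω, (fderiv ℝ η x v) • u x = -∫ x in Ω, η x • Du x v

/-- The Euclidean norm `(|∂₁u|² + |∂₂u|²)^{1/2}` of a differential. -/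
def gradNorm (L : ℂ →L[ℝ] ℂ) : ℝ := Real.sqrt (‖L 1‖ ^ 2 + ‖L Complex.I‖ ^ 2)

/-- The `W^{1,(2,∞)}(D²)` norm `‖u‖_{L^{(2,∞)}} + ‖∇u‖_{L^{(2,∞)}}`. The weak differential is
unique up to null sets, so the infimum is over a single value; it is `∞` when there is no weak
differential. -/
def normW12Weak (u : ℂ → ℂ) : ℝ≥0∞ :=
  ⨅ (Du : ℂ → ℂ →L[ℝ] ℂ) (_ : HasWeakFDeriv disc u Du),
    weakLpNorm u 2 (volume.restrict disc) +
      weakLpNorm (fun x => gradNorm (Du x)) 2 (volume.restrict disc)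

/-- `u ∈ W^{1,(2,∞)}(D², 𝕊¹)`; only the values of `u` on the disc matter. -/
def MemW12Weak (u : ℂ → Circle) : Prop :=
  normW12Weak (fun x => (u x : ℂ)) < ⊤

/-- `u|_{∂D²} = φ` in the sense of traces: some sequence of functions smooth up to the boundary
converges to `u` in `W^{1,1}(D²)` while its restrictions to the circle converge to `φ` in
`L¹(𝕊¹)`. This is the graph of the continuous extension to `W^{1,1}(D²) → L¹(𝕊¹)` of the
restriction of smooth functions to the boundary. -/
def HasTrace (u : ℂ → ℂ) (φ : Circle → ℂ) : Prop :=
  ∃ Du : ℂ → ℂ →L[ℝ] ℂ, HasWeakFDeriv disc u Du ∧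
    ∃ w : ℕ → ℂ → ℂ, (∀ k, ContDiff ℝ ∞ (w k)) ∧
      Tendsto (fun k => eLpNorm (fun x => w k x - u x) 1 (volume.restrict disc)) atTop (𝓝 0) ∧
      Tendsto (fun k => eLpNorm (fun x => fderiv ℝ (w k) x - Du x) 1 (volume.restrict disc))
        atTop (𝓝 0) ∧
      Tendsto (fun k => eLpNorm (fun z : Circle => w k (z : ℂ) - φ z) 1 arcLength) atTop (𝓝 0)

end CircleExtension

end

namespace CircleExtension

open scoped Real Manifold

noncomputable section

/-! The difficulty is that `φ` may have nonzero degree `d`, and then no continuous extension exists;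
but weak `L²` tolerates a gradient of size `1/|x|`, so one singularity at the origin is affordable.

Write `φ = exp (iθ)` with `θ` continuous on the line, `θ (t + 2π) = θ t + 2πd`, and increments of
`θ` controlled by integrals of `|φ'|` (`HasWeakAngularDeriv.exists_lift`). At distance `h = 1 - |x|`
from the boundary, let the phase of `u` be the average of `θ` at scale `h` around `arg x`. The
additive period of `θ` is invisible after exponentiation, so `u` is well defined and smooth off the
origin. Its gradient is at most a constant times the oscillation of `θ` on an interval of
half-length `2h`, divided by `h|x|`. That quantity is dominated by the potential `∫ |φ'(z)| (1/|x| +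
1/|x - z|) dz` (`exists_enorm_fderiv_extension_le`).

The kernel `1/|x - y|` satisfies `∫_E ≤ K |E|^{1/2}` uniformly in `y`
(`setLIntegral_enorm_sub_inv_le`). Such bounds survive integration in `y` and imply the weak `L²`
bound (`weakLpNorm_two_le`), so the final estimate is affine in the norm of `φ`.

For the trace and the weak derivative, `u` is dilated and cut off near the origin. The same set
bounds, uniform along this sequence, give uniform integrability, and Vitali's theorem gives
convergence in `W^{1,1}` (`exists_smooth_approximation`). -/

/-! ### Weak derivatives on the circle in the angular variable -/

theorem measurePreserving_circleExp :
    MeasurePreserving Circle.exp (volume.restrict (Ioc (-π) π)) arcLength :=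
  ⟨Circle.exp.continuous.measurable, rfl⟩

instance : IsFiniteMeasure arcLength := by
  unfold arcLength; infer_instance

/-- The integral against arc length in the angular variable. -/
theorem integral_arcLength {E : Type*} [NormedAddCommGroup E] [NormedSpace ℝ E] {f : Circle → E}
    (hf : AEStronglyMeasurable f arcLength) :
    ∫ z, f z ∂arcLength = ∫ t in (-π)..π, f (Circle.exp t) := by
  rw [intervalIntegral.integral_of_le (by linarith [Real.pi_pos])]
  exact integral_map Circle.exp.continuous.measurable.aemeasurable hf

theorem intervalIntegrable_comp_circleExp {E : Type*} [NormedAddCommGroup E]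
    {f : Circle → E} (hf : Integrable f arcLength) (a b : ℝ) :
    IntervalIntegrable (fun t => f (Circle.exp t)) volume a b := by
  have hp : Function.Periodic (fun t => f (Circle.exp t)) (2 * π) := fun t => by simp
  refine hp.intervalIntegrable (t := -π) (by positivity) ?_ a b
  rw [show -π + 2 * π = π by ring, intervalIntegrable_iff_integrableOn_Ioc_of_le
    (by linarith [Real.pi_pos])]
  exact measurePreserving_circleExp.integrable_comp_of_integrable hf

/-- Integration by parts against a primitive of an integrable function. -/
theorem integral_mul_primitive {p p' f : ℝ → ℝ} {a b : ℝ} (hp : ∀ t, HasDerivAt p (p' t) t)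
    (hp' : Continuous p') (hf : IntervalIntegrable f volume a b) :
    ∫ t in a..b, p' t * ∫ s in a..t, f s =
      p b * (∫ s in a..b, f s) - ∫ t in a..b, p t * f t := by
  have hd : deriv p = p' := funext fun t => (hp t).deriv
  have hpc : ContDiff ℝ 1 p :=
    contDiff_one_iff_deriv.2 ⟨fun t => (hp t).differentiableAt, by rwa [hd]⟩
  have hFac : AbsolutelyContinuousOnInterval (fun t => ∫ s in a..t, f s) a b :=
    hf.absolutelyContinuousOnInterval_intervalIntegral (by simp)
  have hpac : AbsolutelyContinuousOnInterval p a b :=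
    hpc.contDiffOn.absolutelyContinuousOnInterval
  have h := hFac.integral_mul_deriv_eq_deriv_mul hpac
  rw [hd, intervalIntegral.integral_same, zero_mul, sub_zero] at h
  simp_rw [mul_comm (p' _), h, mul_comm (p b)]
  congr 1
  refine intervalIntegral.integral_congr_ae ?_
  filter_upwards [hf.ae_hasDerivAt_integral] with x hx hxm
  rw [(hx (uIoc_subset_uIcc hxm) a (by simp)).deriv, mul_comm]

/-- Integration by parts against a primitive of an integrable complex-valued function. -/
theorem integral_smul_primitive {p p' : ℝ → ℝ} {f : ℝ → ℂ} {a b : ℝ}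
    (hp : ∀ t, HasDerivAt p (p' t) t) (hp' : Continuous p')
    (hf : ∀ a b, IntervalIntegrable f volume a b) :
    ∫ t in a..b, p' t • ∫ s in a..t, f s =
      p b • (∫ s in a..b, f s) - ∫ t in a..b, p t • f t := by
  have hpc : Continuous p := continuous_iff_continuousAt.2 fun t => (hp t).continuousAt
  have hF : Continuous fun t => ∫ s in a..t, f s := intervalIntegral.continuous_primitive hf a
  have h1 : IntervalIntegrable (fun t => p' t • ∫ s in a..t, f s) volume a b :=
    (hp'.smul hF).intervalIntegrable _ _
  have h2 : IntervalIntegrable (fun t => p t • f t) volume a b :=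
    (hf a b).continuousOn_smul hpc.continuousOn
  have key : ∀ L : ℂ →L[ℝ] ℝ, L (∫ t in a..b, p' t • ∫ s in a..t, f s) =
      L (p b • (∫ s in a..b, f s) - ∫ t in a..b, p t • f t) := fun L => by
    have hLf : IntervalIntegrable (fun t => L (f t)) volume a b :=
      ⟨L.integrable_comp (hf a b).1, L.integrable_comp (hf a b).2⟩
    have := integral_mul_primitive hp hp' hLf
    rw [← L.intervalIntegral_comp_comm h1, map_sub, ← L.intervalIntegral_comp_comm h2]
    simp_rw [map_smul, smul_eq_mul, ← L.intervalIntegral_comp_comm (hf _ _)]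
    exact this
  exact Complex.ext (key Complex.reCLM) (key Complex.imCLM)

/-- Periodicity hides the jump of `arg`, so composing with `arg` turns smooth periodic functions on
the line into test functions on the circle. -/
theorem periodic_arg_circleExp {α : Type*} {P : ℝ → α} (hper : Function.Periodic P (2 * π))
    (t : ℝ) : P (Complex.arg (Circle.exp t)) = P t := by
  obtain ⟨m, hm⟩ := Circle.exp_eq_exp.1 (Circle.exp_arg (Circle.exp t))
  rw [hm]
  exact hper.int_mul m t

theorem measurable_circle_coe : Measurable fun z : Circle => (z : ℂ) :=
  Continuous.measurable (γ := ℂ) (α := Circle) continuous_subtype_val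

theorem measurable_circle_arg : Measurable fun z : Circle => Complex.arg z :=
  Complex.measurable_arg.comp measurable_circle_coe

theorem HasWeakAngularDeriv.integral_periodic {φ φ' : Circle → ℂ} (h : HasWeakAngularDeriv φ φ')
    {P : ℝ → ℝ} (hP : ContDiff ℝ ∞ P) (hper : Function.Periodic P (2 * π)) :
    ∫ t in (-π)..π, deriv P t • φ (Circle.exp t) =
      -∫ t in (-π)..π, P t • φ' (Circle.exp t) := by
  have hη : ∀ t, P (Complex.arg (Circle.exp t)) = P t := periodic_arg_circleExp hper
  have had : ∀ s, angularDeriv (fun z => P (Complex.arg z)) (Circle.exp s) = deriv P s := by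
    intro s
    simp only [angularDeriv, ← Circle.exp_add, hη]
    rw [deriv_comp_const_add, add_zero]
  have hmeas : Measurable (angularDeriv fun z => P (Complex.arg z)) := by
    have : (angularDeriv fun z => P (Complex.arg z)) = fun z : Circle => deriv P (Complex.arg z) := by
      funext z
      conv_lhs => rw [← Circle.exp_arg z]
      exact had _
    rw [this]
    exact (hP.continuous_deriv (by simp)).measurable.comp measurable_circle_arg
  have key := h.integral_eq (fun z => P (Complex.arg z)) (by simpa only [hη] using hP)
  have m1 : AEStronglyMeasurable
      (fun z => angularDeriv (fun z => P (Complex.arg z)) z • φ z) arcLength :=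
    hmeas.aestronglyMeasurable.smul h.integrable.aestronglyMeasurable
  have m2 : AEStronglyMeasurable (fun z : Circle => P (Complex.arg z) • φ' z) arcLength :=
    (hP.continuous.measurable.comp measurable_circle_arg).aestronglyMeasurable.smul
      h.integrable_deriv.aestronglyMeasurable
  rw [integral_arcLength m1, integral_arcLength m2] at key
  simpa only [had, hη] using key

/-- Test against the constant 1. Zero mean is what makes the primitive of `φ'` periodic. -/
theorem HasWeakAngularDeriv.integral_deriv_eq_zero {φ φ' : Circle → ℂ}
    (h : HasWeakAngularDeriv φ φ') : ∫ t in (-π)..π, φ' (Circle.exp t) = 0 := by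
  simpa using h.integral_periodic (P := fun _ => 1) contDiff_const (fun _ => rfl)

theorem HasWeakAngularDeriv.periodic_primitive {φ φ' : Circle → ℂ}
    (h : HasWeakAngularDeriv φ φ') :
    Function.Periodic (fun t => ∫ s in (-π)..t, φ' (Circle.exp s)) (2 * π) := by
  intro t
  have hp : Function.Periodic (fun t => φ' (Circle.exp t)) (2 * π) := fun t => by simp
  have hi := intervalIntegrable_comp_circleExp h.integrable_deriv
  have h1 := hp.intervalIntegral_add_eq t (-π)
  rw [show -π + 2 * π = π by ring, h.integral_deriv_eq_zero] at h1
  simp only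
  rw [← intervalIntegral.integral_add_adjacent_intervals (hi (-π) t) (hi t _), h1, add_zero]

theorem contDiff_intervalIntegral {p : ℝ → ℝ} (hp : ContDiff ℝ ∞ p) (a : ℝ) :
    ContDiff ℝ ∞ fun t => ∫ s in a..t, p s := by
  have hd : ∀ t, HasDerivAt (fun t => ∫ s in a..t, p s) (p t) t := fun t =>
    intervalIntegral.integral_hasDerivAt_right (hp.continuous.intervalIntegrable _ _)
      (hp.continuous.stronglyMeasurableAtFilter _ _) hp.continuous.continuousAt
  exact contDiff_infty_iff_deriv.2 ⟨fun t => (hd t).differentiableAt,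
    by rwa [show deriv (fun t => ∫ s in a..t, p s) = p from funext fun t => (hd t).deriv]⟩

/-- A map with an integrable weak derivative is a.e. a primitive of that derivative. -/
theorem HasWeakAngularDeriv.exists_ae_eq_primitive {φ φ' : Circle → ℂ}
    (h : HasWeakAngularDeriv φ φ') :
    ∃ c : ℂ, ∀ᵐ z ∂arcLength, φ z = c + ∫ s in (-π)..(Complex.arg (z : ℂ)), φ' (Circle.exp s) := by
  set F : ℝ → ℂ := fun t => ∫ s in (-π)..t, φ' (Circle.exp s) with hF
  have hi := intervalIntegrable_comp_circleExp h.integrable_deriv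
  have hiφ := intervalIntegrable_comp_circleExp h.integrable
  have hFc : Continuous F := intervalIntegral.continuous_primitive hi _
  have hFper : Function.Periodic F (2 * π) := h.periodic_primitive
  have hFm : Measurable fun z : Circle => F (Complex.arg z) :=
    hFc.measurable.comp measurable_circle_arg
  have hFi : Integrable (fun z : Circle => F (Complex.arg z)) arcLength := by
    obtain ⟨B, hB⟩ := isCompact_Icc.exists_bound_of_continuousOn (s := Icc (-π) π)
      hFc.continuousOn
    refine Integrable.of_bound hFm.aestronglyMeasurable B (ae_of_all _ fun z => hB _ ?_)
    exact ⟨(Complex.neg_pi_lt_arg _).le, Complex.arg_le_pi _⟩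
  -- The mean of `φ - F`, the only possible value of the constant.
  set c : ℂ := ((2 * π)⁻¹ : ℝ) • ∫ t in (-π)..π, (φ (Circle.exp t) - F t) with hc
  have hGi : Integrable (fun z : Circle => φ z - F (Complex.arg z) - c) arcLength :=
    (h.integrable.sub hFi).sub (integrable_const c)
  refine ⟨c, ?_⟩
  have main : ∀ᵐ z ∂arcLength, φ z - F (Complex.arg z) - c = 0 := by
    -- Du Bois-Reymond argument: a test function minus its mean `m` is the derivative of a periodic
    -- `P`, against which `φ - F` integrates to zero; the choice of `c` takes care of the mean.
    refine ae_eq_zero_of_integral_contMDiff_smul_eq_zero (𝓡 1) hGi.locallyIntegrable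
      fun g hg _ => ?_
    set p : ℝ → ℝ := fun t => g (Circle.exp t) with hp
    have hps : ContDiff ℝ ∞ p := (hg.comp contMDiff_circleExp).contDiff
    have hpper : Function.Periodic p (2 * π) := fun t => by simp [hp]
    set m : ℝ := (2 * π)⁻¹ * ∫ t in (-π)..π, p t with hm
    have hqs : ContDiff ℝ ∞ fun t => p t - m := hps.sub contDiff_const
    have hpi : ∀ a b, IntervalIntegrable p volume a b := fun a b =>
      hps.continuous.intervalIntegrable a b
    set P : ℝ → ℝ := fun t => ∫ s in (-π)..t, (p s - m) with hP
    have hPs : ContDiff ℝ ∞ P := contDiff_intervalIntegral hqs _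
    have hPd : ∀ t, HasDerivAt P (p t - m) t := fun t =>
      intervalIntegral.integral_hasDerivAt_right (hqs.continuous.intervalIntegrable _ _)
        (hqs.continuous.stronglyMeasurableAtFilter _ _) hqs.continuous.continuousAt
    have hPπ : P π = 0 := by
      simp only [hP]
      rw [intervalIntegral.integral_sub (hpi _ _) (by simp), intervalIntegral.integral_const, hm,
        smul_eq_mul]
      field_simp
      ring
    have hPper : Function.Periodic P (2 * π) := fun t => by
      have h1 := Function.Periodic.intervalIntegral_add_eq (f := fun t => p t - m) (T := 2 * π)
        (fun t => by simp [hpper t]) t (-π)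
      rw [show -π + 2 * π = π by ring] at h1
      change _ = P π at h1
      simp only [hP]
      rw [← intervalIntegral.integral_add_adjacent_intervals
        (hqs.continuous.intervalIntegrable (-π) t) (hqs.continuous.intervalIntegrable t _), h1,
        hPπ, add_zero]
    have h1 := h.integral_periodic hPs hPper
    have h2 := integral_smul_primitive hPd hqs.continuous hi (a := -π) (b := π)
    rw [hPπ, zero_smul, zero_sub, ← h1] at h2
    simp only [(hPd _).deriv] at h2
    have i1 : IntervalIntegrable (fun t => φ (Circle.exp t) - F t) volume (-π) π :=
      (hiφ _ _).sub (hFc.intervalIntegrable _ _)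
    have i2 : IntervalIntegrable (fun t => (p t - m) • φ (Circle.exp t)) volume (-π) π :=
      (hiφ _ _).continuousOn_smul hqs.continuous.continuousOn
    have i3 : IntervalIntegrable (fun t => (p t - m) • F t) volume (-π) π :=
      (hqs.continuous.smul hFc).intervalIntegrable _ _
    have i4 : IntervalIntegrable (fun t => p t • (φ (Circle.exp t) - F t)) volume (-π) π :=
      i1.continuousOn_smul hps.continuous.continuousOn
    have i5 : IntervalIntegrable (fun t => m • (φ (Circle.exp t) - F t)) volume (-π) π := i1.smul m
    have i6 : IntervalIntegrable (fun t => p t • c) volume (-π) π :=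
      (hps.continuous.smul continuous_const).intervalIntegrable _ _
    have h3 : ∫ t in (-π)..π, (p t - m) • (φ (Circle.exp t) - F t) = 0 := by
      simp only [smul_sub (_ - m)]
      rw [intervalIntegral.integral_sub i2 i3, h2, sub_self]
    simp only [sub_smul] at h3
    rw [intervalIntegral.integral_sub i4 i5, intervalIntegral.integral_smul, sub_eq_zero] at h3
    have m1 : AEStronglyMeasurable (fun z => g z • (φ z - F (Complex.arg z) - c)) arcLength :=
      hg.continuous.aestronglyMeasurable.smul hGi.aestronglyMeasurable
    rw [integral_arcLength m1]
    simp only [periodic_arg_circleExp hFper]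
    change ∫ t in (-π)..π, p t • (φ (Circle.exp t) - F t - c) = 0
    simp only [smul_sub (p _) _ c]
    rw [intervalIntegral.integral_sub i4 i6, intervalIntegral.integral_smul_const, h3, hm, hc,
      smul_smul, mul_comm, sub_self]
  filter_upwards [main] with z hz
  rw [sub_sub, sub_eq_zero] at hz
  rw [hz, add_comm]

/-! ### Lifting to the line -/

/-- The chord is `2 |sin ((b - a) / 2)|`, and Jordan's inequality bounds the sine below. The
restriction to arcs of at most half a turn is removed by subdivision in the next lemma. -/
theorem abs_sub_le_norm_circleExp_sub {a b : ℝ} (h : |b - a| ≤ π) :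
    |b - a| ≤ π / 2 * ‖(Circle.exp b : ℂ) - Circle.exp a‖ := by
  have h1 : (Circle.exp b : ℂ) - Circle.exp a
      = Circle.exp a * (Complex.exp (Complex.I * ((b - a : ℝ) : ℂ)) - 1) := by
    rw [Circle.coe_exp, Circle.coe_exp, mul_sub, ← Complex.exp_add, mul_one]
    congr 2
    push_cast
    ring
  rw [h1, norm_mul, Circle.norm_coe, one_mul, Complex.norm_exp_I_mul_ofReal_sub_one, norm_mul,
    Real.norm_eq_abs, Real.norm_eq_abs, abs_two, Real.abs_sin_eq_sin_abs_of_abs_le_pi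
      (by rw [abs_div, abs_two]; linarith [abs_nonneg (b - a), Real.pi_pos]), abs_div, abs_two]
  have h2 := Real.mul_le_sin (x := |b - a| / 2) (by positivity) (by linarith)
  have h3 : π / 2 * (2 / π * (|b - a| / 2)) = |b - a| / 2 := by field_simp
  nlinarith [mul_le_mul_of_nonneg_left h2 (by positivity : (0 : ℝ) ≤ π / 2)]

/-- A continuous function whose small increments are bounded by the integral of `g` has all its
increments bounded in this way. -/
theorem abs_sub_le_integral_of_local {θ g : ℝ → ℝ} {r : ℝ} (hr : 0 < r) (hθ : Continuous θ)
    (hg : ∀ a b, IntervalIntegrable g volume a b)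
    (hloc : ∀ a b, a ≤ b → |θ b - θ a| ≤ r → |θ b - θ a| ≤ ∫ s in a..b, g s)
    {a b : ℝ} (hab : a ≤ b) : |θ b - θ a| ≤ ∫ s in a..b, g s := by
  -- Uniform continuity gives a mesh on which every increment is at most `r`; the local bounds then
  -- add up along the partition.
  obtain ⟨δ, hδ, h⟩ := Metric.uniformContinuousOn_iff_le.1
    (isCompact_Icc.uniformContinuousOn_of_continuous (hθ.continuousOn (s := Icc a b))) r hr
  obtain ⟨n, hn⟩ := exists_nat_gt ((b - a) / δ)
  have hn0 : (0 : ℝ) < n := lt_of_le_of_lt (div_nonneg (by linarith) hδ.le) hn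
  have hstep : (b - a) / n ≤ δ := by
    rw [div_le_iff₀ hn0]
    rw [div_lt_iff₀ hδ] at hn
    linarith
  have hstep0 : 0 ≤ (b - a) / n := div_nonneg (by linarith) hn0.le
  set x : ℕ → ℝ := fun i => a + i * ((b - a) / n) with hx
  have hx0 : x 0 = a := by simp [hx]
  have hxn : x n = b := by simp only [hx]; field_simp; ring
  have hxs : ∀ i, x (i + 1) = x i + (b - a) / n := fun i => by simp only [hx]; push_cast; ring
  have hmono : Monotone x := monotone_nat_of_le_succ fun i => by rw [hxs]; linarith
  have hmem : ∀ i ≤ n, x i ∈ Icc a b := fun i hi =>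
    ⟨hx0 ▸ hmono (Nat.zero_le i), hxn ▸ hmono hi⟩
  have h1 := dist_le_range_sum_dist (fun i => θ (x i)) n
  rw [hx0, hxn, dist_comm, Real.dist_eq] at h1
  rw [← hx0, ← hxn, ← intervalIntegral.sum_integral_adjacent_intervals fun k _ => hg _ _]
  rw [hx0, hxn]
  refine h1.trans (Finset.sum_le_sum fun i hi => ?_)
  have hi' := Finset.mem_range.1 hi
  rw [dist_comm, Real.dist_eq]
  refine hloc _ _ (hmono i.le_succ) ?_
  refine h _ (hmem _ hi') _ (hmem _ hi'.le) ?_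
  rw [Real.dist_eq, hxs, add_sub_cancel_left, abs_of_nonneg hstep0]
  exact hstep

/-- A `W^{1,1}` map of the circle has a continuous lift of bounded variation. -/
theorem HasWeakAngularDeriv.exists_lift {φ : Circle → Circle} {φ' : Circle → ℂ}
    (h : HasWeakAngularDeriv (fun z => (φ z : ℂ)) φ') :
    ∃ θ : ℝ → ℝ, Continuous θ ∧ (∃ d : ℤ, ∀ t, θ (t + 2 * π) = θ t + d * (2 * π)) ∧
      (∀ᵐ z ∂arcLength, φ z = Circle.exp (θ (Complex.arg z))) ∧
      ∀ a b, a ≤ b → |θ b - θ a| ≤ ∫ s in a..b, π / 2 * ‖φ' (Circle.exp s)‖ := by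
  obtain ⟨c, hc⟩ := h.exists_ae_eq_primitive
  have hi := intervalIntegrable_comp_circleExp h.integrable_deriv
  set F : ℝ → ℂ := fun t => c + ∫ s in (-π)..t, φ' (Circle.exp s) with hF
  have hFc : Continuous F := continuous_const.add (intervalIntegral.continuous_primitive hi _)
  have hFper : Function.Periodic F (2 * π) := fun t =>
    congrArg (c + ·) (h.periodic_primitive t)
  replace hc : ∀ᵐ z : Circle ∂arcLength, (φ z : ℂ) = F (Complex.arg z) := hc
  have hFarg := periodic_arg_circleExp hFper
  have h1 : ∀ᵐ t ∂volume.restrict (Icc (-π) π), ‖F t‖ = 1 := by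
    rw [← restrict_Ioc_eq_restrict_Icc]
    filter_upwards [measurePreserving_circleExp.quasiMeasurePreserving.ae hc] with t ht
    exact hFarg t ▸ ht ▸ Circle.norm_coe _
  -- The primitive equals `φ` only almost everywhere, but continuity of `F` upgrades `‖F‖ = 1` to
  -- every point, so it can be lifted through the covering `Circle.exp`.
  have h2 : ∀ t ∈ Icc (-π) π, ‖F t‖ = 1 := Measure.eqOn_Icc_of_ae_eq volume
    (by linarith [Real.pi_pos]) h1 hFc.norm.continuousOn continuousOn_const
  have h3 : ∀ t, ‖F t‖ = 1 := fun t => by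
    rw [← hFarg]
    exact h2 _ ⟨(Complex.neg_pi_lt_arg _).le, Complex.arg_le_pi _⟩
  let f : C(ℝ, Circle) :=
    ⟨fun t => ⟨F t, mem_sphere_zero_iff_norm.2 (h3 t)⟩, hFc.subtype_mk _⟩
  obtain ⟨Θ, ⟨-, hΘ⟩, -⟩ := Circle.isCoveringMap_exp.existsUnique_continuousMap_lifts f 0
    (Complex.arg (f 0)) (Circle.exp_arg _)
  have hΘf : ∀ t, Circle.exp (Θ t) = f t := fun t => congr_fun hΘ t
  have hΘF : ∀ t, (Circle.exp (Θ t) : ℂ) = F t := fun t => by rw [hΘf]; rfl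
  refine ⟨Θ, Θ.continuous, ?_, ?_, ?_⟩
  · have hk : ∀ t, ∃ m : ℤ, Θ (t + 2 * π) - Θ t = m * (2 * π) := fun t => by
      obtain ⟨m, hm⟩ := Circle.exp_eq_exp.1 (Circle.ext (by rw [hΘF, hΘF, hFper t]) :
        Circle.exp (Θ (t + 2 * π)) = Circle.exp (Θ t))
      exact ⟨m, by rw [hm]; ring⟩
    choose k hk using hk
    -- A continuous integer-valued function on the line is constant; its value is the degree.
    have hkc : Continuous k := by
      rw [Int.isClosedEmbedding_coe_real.isEmbedding.continuous_iff]
      have : ((↑) : ℤ → ℝ) ∘ k = fun t => (Θ (t + 2 * π) - Θ t) / (2 * π) := by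
        funext t
        rw [hk]
        simp
      rw [this]
      fun_prop
    refine ⟨k 0, fun t => ?_⟩
    rw [← PreconnectedSpace.constant inferInstance hkc (x := t) (y := 0), ← hk]
    ring
  · filter_upwards [hc] with z hz
    exact Circle.ext (by rw [hz, hΘF])
  · intro a b hab
    refine abs_sub_le_integral_of_local Real.pi_pos Θ.continuous
      (fun a b => ((hi a b).norm.const_mul _)) (fun a b hab hle => ?_) hab
    refine (abs_sub_le_norm_circleExp_sub hle).trans ?_
    rw [hΘF, hΘF, intervalIntegral.integral_const_mul]
    gcongr
    simp only [hF, add_sub_add_left_eq_sub]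
    rw [intervalIntegral.integral_interval_sub_left (hi _ _) (hi _ _)]
    exact intervalIntegral.norm_integral_le_integral_norm hab

/-! ### Mollification at a variable scale -/

/-- A fixed bump function on the line, supported in the unit interval. -/
def lineBump : ContDiffBump (0 : ℝ) := ⟨1 / 2, 1, by norm_num, by norm_num⟩

/-- The mollifier at scale `h`. -/
def mollifier (h y : ℝ) : ℝ := h⁻¹ * lineBump.normed volume (h⁻¹ * y)

/-- The average of `θ` at scale `h` around `t`. -/
def average (θ : ℝ → ℝ) (h t : ℝ) : ℝ :=
  convolution (mollifier h) θ (ContinuousLinearMap.lsmul ℝ ℝ) volume t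

theorem support_mollifier {h : ℝ} (hh : 0 < h) :
    Function.support (mollifier h) ⊆ Metric.ball 0 h := by
  intro y hy
  have h1 : h⁻¹ * y ∈ Function.support (lineBump.normed volume) := by
    intro h0
    exact hy (by simp [mollifier, h0])
  rw [ContDiffBump.support_normed_eq] at h1
  simp only [Metric.mem_ball, dist_zero_right, norm_mul, norm_inv, Real.norm_eq_abs,
    abs_of_pos hh, lineBump] at h1 ⊢
  rwa [inv_mul_lt_iff₀ hh, mul_one] at h1

theorem mollifier_nonneg {h : ℝ} (hh : 0 < h) (y : ℝ) : 0 ≤ mollifier h y :=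
  mul_nonneg (inv_nonneg.2 hh.le) (lineBump.nonneg_normed _)

theorem integral_mollifier {h : ℝ} (hh : 0 < h) : ∫ y, mollifier h y = 1 := by
  simp only [mollifier]
  rw [integral_const_mul, Measure.integral_comp_mul_left (lineBump.normed volume),
    lineBump.integral_normed]
  simp [abs_of_pos hh, hh.ne']

/-- Joint smoothness is required because the scale varies with the point of the disc. -/
theorem contDiffOn_mollifier :
    ContDiffOn ℝ ∞ (fun q : ℝ × ℝ => mollifier q.1 q.2) (Ioi 0 ×ˢ univ) := by
  have h1 : ContDiffOn ℝ ∞ (fun q : ℝ × ℝ => q.1⁻¹) (Ioi 0 ×ˢ univ) :=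
    contDiffOn_fst.inv fun q hq => ne_of_gt hq.1
  exact h1.mul ((lineBump.contDiff_normed (n := ⊤)).comp_contDiffOn (h1.mul contDiffOn_snd))

theorem continuous_mollifier (h : ℝ) : Continuous (mollifier h) :=
  continuous_const.mul (lineBump.continuous_normed.comp (continuous_const.mul continuous_id))

theorem contDiffOn_average {θ : ℝ → ℝ} (hθ : Continuous θ) :
    ContDiffOn ℝ ∞ (fun q : ℝ × ℝ => average θ q.1 q.2) (Ioo 0 1 ×ˢ univ) := by
  refine contDiffOn_convolution_left_with_param (ContinuousLinearMap.lsmul ℝ ℝ) isOpen_Ioo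
    (isCompact_Icc (a := (-1 : ℝ)) (b := 1)) (fun p x hp hx => ?_) hθ.locallyIntegrable
    (contDiffOn_mollifier.mono (prod_mono (fun p hp => hp.1) Subset.rfl))
  by_contra h0
  have := support_mollifier hp.1 h0
  rw [Metric.mem_ball, dist_zero_right, Real.norm_eq_abs, abs_lt] at this
  exact hx ⟨by linarith [hp.2], by linarith [hp.2]⟩

theorem dist_average_le {θ : ℝ → ℝ} (hθ : Continuous θ) {h t c ε : ℝ} (hh : 0 < h) (hε : 0 ≤ ε)
    (hb : ∀ s ∈ Metric.ball t h, dist (θ s) c ≤ ε) : dist (average θ h t) c ≤ ε :=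
  dist_convolution_le hε (support_mollifier hh) (mollifier_nonneg hh) (integral_mollifier hh)
    hθ.aestronglyMeasurable hb

theorem tendsto_average {θ : ℝ → ℝ} (hθ : Continuous θ) (t : ℝ) :
    Tendsto (fun h => average θ h t) (𝓝[>] 0) (𝓝 (θ t)) := by
  rw [Metric.tendsto_nhds]
  intro ε hε
  obtain ⟨δ, hδ, hb⟩ := Metric.continuousAt_iff.1 hθ.continuousAt (ε / 2) (half_pos hε)
  filter_upwards [Ioo_mem_nhdsGT hδ] with h hh
  exact (dist_average_le hθ hh.1 (half_pos hε).le fun s hs =>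
    (hb (hs.trans hh.2)).le).trans_lt (half_lt_self hε)

theorem integrable_mollifier_smul {θ : ℝ → ℝ} (hθ : Continuous θ) {h : ℝ} (hh : 0 < h) (t : ℝ) :
    Integrable (fun s => mollifier h (t - s) * θ s) := by
  refine Continuous.integrable_of_hasCompactSupport
    (((continuous_mollifier h).comp (by fun_prop)).mul hθ) ?_
  refine HasCompactSupport.intro (isCompact_closedBall t h) fun s hs => ?_
  have : mollifier h (t - s) = 0 := by
    by_contra h0
    have := support_mollifier hh h0
    rw [mem_ball_zero_iff, Real.norm_eq_abs, abs_sub_comm] at this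
    exact hs (by rw [Metric.mem_closedBall, Real.dist_eq]; exact this.le)
  rw [this, zero_mul]

/-- Unit mass lets a constant pass through the average, so estimates involve the oscillation of `θ`
and not its size. -/
theorem average_sub_const {θ : ℝ → ℝ} (hθ : Continuous θ) {h : ℝ} (hh : 0 < h) (t c : ℝ) :
    average θ h t - c = ∫ s, mollifier h (t - s) * (θ s - c) := by
  have h1 : ∫ s, mollifier h (t - s) * c = c := by
    rw [integral_mul_const, integral_sub_left_eq_self (mollifier h), integral_mollifier hh,
      one_mul]
  simp only [mul_sub]
  rw [integral_sub (integrable_mollifier_smul hθ hh t)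
    (integrable_mollifier_smul continuous_const hh t), h1, average, convolution_lsmul_swap]
  simp only [smul_eq_mul]

theorem average_add_period {θ : ℝ → ℝ} (hθ : Continuous θ) {T c : ℝ}
    (hp : ∀ t, θ (t + T) = θ t + c) {h : ℝ} (hh : 0 < h) (t : ℝ) :
    average θ h (t + T) = average θ h t + c := by
  have h1 := average_sub_const hθ hh (t + T) c
  rw [← integral_add_right_eq_self _ T] at h1
  simp only [hp, add_sub_add_right_eq_sub, add_sub_cancel_right] at h1
  have h2 := average_sub_const hθ hh t 0
  simp only [sub_zero] at h2
  linarith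

/-- The mollifier is homogeneous of degree -1 in `(h, y)`, so rescaling reduces to a compact box
around scale 1, where it is Lipschitz. One factor `h⁻¹` is the homogeneity, the other comes from
rescaling the increment. -/
theorem exists_mollifier_lipschitz :
    ∃ L : ℝ≥0, ∀ h h' y y' : ℝ, 0 < h → |h' - h| ≤ h / 2 → |y' - y| ≤ h / 2 → |y| ≤ 2 * h →
      |mollifier h' y' - mollifier h y| ≤ L / h ^ 2 * ‖((h' - h, y' - y) : ℝ × ℝ)‖ := by
  have hsub : Icc (1 / 2 : ℝ) (3 / 2) ×ˢ Icc (-3 : ℝ) 3 ⊆ Ioi 0 ×ˢ univ :=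
    prod_mono (fun x hx => lt_of_lt_of_le (by norm_num) hx.1) (subset_univ _)
  obtain ⟨L, hL⟩ := ((contDiffOn_mollifier.of_le (m := 1) (by simp)).mono hsub).exists_lipschitzOnWith
    (by simp) ((convex_Icc _ _).prod (convex_Icc _ _)) (isCompact_Icc.prod isCompact_Icc)
  refine ⟨L, fun h h' y y' hh h1 h2 h3 => ?_⟩
  rw [abs_le] at h1 h2 h3
  have e : ∀ k x, mollifier k x = h⁻¹ * mollifier (k / h) (x / h) := fun k x => by
    simp only [mollifier]
    rw [show (k / h)⁻¹ * (x / h) = k⁻¹ * x by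
      rw [inv_div]; field_simp, inv_div, ← mul_assoc, ← mul_div_assoc, inv_mul_cancel₀ hh.ne',
      one_div]
  have hm : ∀ k x : ℝ, h / 2 ≤ k → k ≤ 3 * h / 2 → -3 * h ≤ x → x ≤ 3 * h →
      ((k / h, x / h) : ℝ × ℝ) ∈ Icc (1 / 2 : ℝ) (3 / 2) ×ˢ Icc (-3 : ℝ) 3 :=
    fun k x a b c d => by
      refine ⟨⟨?_, ?_⟩, ⟨?_, ?_⟩⟩ <;> simp only <;> first
        | rw [le_div_iff₀ hh]; linarith
        | rw [div_le_iff₀ hh]; linarith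
  have := hL.norm_sub_le (hm h' y' (by linarith) (by linarith) (by linarith) (by linarith))
    (hm h y (by linarith) (by linarith) (by linarith) (by linarith))
  rw [e h' y', e h y, ← mul_sub, abs_mul, abs_of_pos (inv_pos.2 hh)]
  simp only [Real.norm_eq_abs] at this
  calc _ ≤ h⁻¹ * (L * ‖((h' / h, y' / h) : ℝ × ℝ) - (h / h, y / h)‖) := by gcongr
    _ = h⁻¹ * (L * ‖h⁻¹ • ((h' - h, y' - y) : ℝ × ℝ)‖) := by
        congr 3
        ext <;> simp <;> ring
    _ = _ := by
        rw [norm_smul, norm_inv, Real.norm_eq_abs, abs_of_pos hh]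
        field_simp

/-- The differential of the averages is controlled by the oscillation. -/
theorem exists_norm_fderiv_average_le :
    ∃ C : ℝ≥0, ∀ θ : ℝ → ℝ, Continuous θ → ∀ h t w : ℝ, 0 < h →
      (∀ s, |s - t| ≤ 2 * h → |θ s - θ t| ≤ w) →
      ‖fderiv ℝ (fun q : ℝ × ℝ => average θ q.1 q.2) (h, t)‖ ≤ C * w / h := by
  obtain ⟨L, hL⟩ := exists_mollifier_lipschitz
  -- The difference of kernels is at most `L / h ^ 2` times the increment and lives on an interval
  -- of length `4h`.
  refine ⟨4 * L, fun θ hθ h t w hh hw => ?_⟩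
  have hw0 : 0 ≤ w := (abs_nonneg _).trans (hw t (by simp [hh.le]))
  refine norm_fderiv_le_of_lip' ℝ (by positivity) ?_
  filter_upwards [Metric.ball_mem_nhds ((h, t) : ℝ × ℝ) (half_pos hh)] with q hq
  obtain ⟨h', t'⟩ := q
  rw [Metric.mem_ball, dist_eq_norm, Prod.mk_sub_mk] at hq
  have h1 : |h' - h| ≤ h / 2 := (norm_fst_le ((h' - h, t' - t) : ℝ × ℝ)).trans hq.le
  have h2 : |t' - t| ≤ h / 2 := (norm_snd_le ((h' - h, t' - t) : ℝ × ℝ)).trans hq.le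
  have hh' : 0 < h' := by linarith [(abs_le.1 h1).1]
  have hθc : Continuous fun s => θ s - θ t := hθ.sub continuous_const
  simp only
  rw [← sub_sub_sub_cancel_right _ _ (θ t), average_sub_const hθ hh', average_sub_const hθ hh,
    ← integral_sub (integrable_mollifier_smul hθc hh' t')
      (integrable_mollifier_smul hθc hh t)]
  set N := ‖((h', t') : ℝ × ℝ) - (h, t)‖ with hN
  have hzero : ∀ s, s ∉ Icc (t - 2 * h) (t + 2 * h) →
      mollifier h' (t' - s) * (θ s - θ t) - mollifier h (t - s) * (θ s - θ t) = 0 := by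
    intro s hs
    -- For the perturbed point, `|t' - t| ≤ h / 2` and `h' ≤ 3h / 2`, which add up to exactly `2h`.
    have key : ∀ k u : ℝ, 0 < k → |u - t| + k ≤ 2 * h → mollifier k (u - s) = 0 := by
      intro k u hk hku
      by_contra h0
      have := support_mollifier hk h0
      rw [mem_ball_zero_iff, Real.norm_eq_abs] at this
      refine hs ?_
      obtain ⟨a, b⟩ := abs_lt.1 this
      constructor <;> linarith [neg_abs_le (u - t), le_abs_self (u - t)]
    rw [key h' t' hh' (by linarith [(abs_le.1 h1).2]), key h t hh (by simp; linarith)]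
    simp
  rw [← setIntegral_eq_integral_of_forall_compl_eq_zero (s := Icc (t - 2 * h) (t + 2 * h)) hzero]
  refine (norm_setIntegral_le_of_norm_le_const (C := L / h ^ 2 * N * w) (by simp) ?_).trans ?_
  · intro s hs
    have hst : |s - t| ≤ 2 * h := abs_le.2 ⟨by linarith [hs.1], by linarith [hs.2]⟩
    rw [← sub_mul, norm_mul]
    have := hL h h' (t - s) (t' - s) hh h1 (by simpa using h2) (by rwa [abs_sub_comm])
    rw [sub_sub_sub_cancel_right] at this
    gcongr
    · exact this
    · exact hw s hst
  · rw [Real.volume_real_Icc_of_le (by linarith)]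
    push_cast
    apply le_of_eq
    field_simp
    ring

/-! ### The extension and its differential -/

/-- The extension to the disc of the circle-valued map with lift `θ`: at distance `h` from the
boundary the lift is averaged at scale `h`. -/
def extension (θ : ℝ → ℝ) (x : ℂ) : Circle :=
  Circle.exp (average θ (1 - ‖x‖) (Complex.arg x))

theorem circleExp_average_periodic {θ : ℝ → ℝ} (hθ : Continuous θ) {d : ℤ}
    (hp : ∀ t, θ (t + 2 * π) = θ t + d * (2 * π)) {h : ℝ} (hh : 0 < h) :
    Function.Periodic (fun t => Circle.exp (average θ h t)) (2 * π) := fun t => by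
  simp only
  rw [average_add_period hθ hp hh]
  exact Circle.exp_eq_exp.2 ⟨d, rfl⟩

theorem coe_circleExp_arg {x : ℂ} (hx : x ≠ 0) :
    (Circle.exp (Complex.arg x) : ℂ) = x / ‖x‖ := by
  rw [Circle.coe_exp, eq_div_iff (by simpa using hx), mul_comm]
  exact Complex.norm_mul_exp_arg_mul_I x

/-- Rotating by `-τ` moves the branch cut of `arg` away from the direction `τ`; the two angles
differ by a multiple of `2π`, which the exponential of the average does not see. -/
theorem extension_eq_rotate {θ : ℝ → ℝ} (hθ : Continuous θ) {d : ℤ}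
    (hp : ∀ t, θ (t + 2 * π) = θ t + d * (2 * π)) (τ : ℝ) {x : ℂ} (hx : x ≠ 0) (hx1 : ‖x‖ < 1) :
    extension θ x = Circle.exp (average θ (1 - ‖x‖)
      (τ + Complex.arg (x * (Circle.exp (-τ) : ℂ)))) := by
  have h1 : Circle.exp (τ + Complex.arg (x * (Circle.exp (-τ) : ℂ)))
      = Circle.exp (Complex.arg x) := by
    refine Circle.ext ?_
    rw [Circle.exp_add, Circle.coe_mul, coe_circleExp_arg hx,
      coe_circleExp_arg (mul_ne_zero hx (Circle.coe_ne_zero _)), norm_mul, Circle.norm_coe, mul_one,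
      Circle.exp_neg, Circle.coe_inv]
    field_simp
  obtain ⟨k, hk⟩ := Circle.exp_eq_exp.1 h1
  rw [hk]
  exact ((circleExp_average_periodic hθ hp (by linarith)).int_mul k _).symm

/-- After rotation `x` becomes a positive real, where the angle is the imaginary part of a logarithm
with complex derivative `x⁻¹`. The radial component is 1-Lipschitz and `1 ≤ ‖x‖⁻¹`; the product
carries the sup norm. -/
theorem polar_contDiffAt_and_norm_fderiv_le {x : ℂ} (hx : x ≠ 0) (hx1 : ‖x‖ < 1) :
    ContDiffAt ℝ ∞ (fun y : ℂ => (1 - ‖y‖, Complex.arg x +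
      Complex.arg (y * (Circle.exp (-Complex.arg x) : ℂ)))) x ∧
    ‖fderiv ℝ (fun y : ℂ => (1 - ‖y‖, Complex.arg x +
      Complex.arg (y * (Circle.exp (-Complex.arg x) : ℂ)))) x‖ ≤ ‖x‖⁻¹ := by
  set c : ℂ := (Circle.exp (-Complex.arg x) : ℂ) with hc
  have hc0 : c ≠ 0 := Circle.coe_ne_zero _
  have hxc : x * c = (‖x‖ : ℂ) := by
    rw [hc, Circle.exp_neg, Circle.coe_inv, coe_circleExp_arg hx]
    field_simp
  have hpos : 0 < ‖x‖ := norm_pos_iff.2 hx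
  have hslit : x * c ∈ Complex.slitPlane := by
    rw [hxc]; exact Or.inl (by simpa using hpos)
  have hlog : HasDerivAt (fun y : ℂ => Complex.log (y * c)) x⁻¹ x := by
    convert! ((hasDerivAt_id x).mul_const c).clog hslit using 1
    simp only [id_eq, one_mul]
    field_simp
  have h2 : HasFDerivAt (fun y : ℂ => Complex.arg x + Complex.arg (y * c))
      (Complex.imCLM.comp (x⁻¹ • (1 : ℂ →L[ℝ] ℂ))) x := by
    have := (Complex.imCLM.hasFDerivAt.comp x hlog.complexToReal_fderiv).const_add (Complex.arg x)
    simpa [Function.comp_def, Complex.log_im] using this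
  have h1 : HasFDerivAt (fun y : ℂ => 1 - ‖y‖) (-fderiv ℝ (fun y : ℂ => ‖y‖) x) x :=
    ((contDiffAt_norm ℝ hx).differentiableAt (n := 1) (by simp)).hasFDerivAt.const_sub 1
  constructor
  · refine (contDiffAt_const.sub (contDiffAt_norm ℝ hx)).prodMk (contDiffAt_const.add ?_)
    have h3 : ContDiffAt ℝ ∞ (fun y : ℂ => Complex.log (y * c)) x :=
      ((Complex.contDiffAt_log hslit).comp (f := fun y => y * c) x
        (contDiffAt_id.mul contDiffAt_const)).restrict_scalars ℝ
    have h4 : (fun y : ℂ => Complex.arg (y * c)) = Complex.imCLM ∘ fun y => Complex.log (y * c) := by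
      funext y
      simp [Complex.log_im]
    rw [h4]
    exact Complex.imCLM.contDiff.contDiffAt.comp x h3
  · rw [(h1.prodMk h2).fderiv, ContinuousLinearMap.opNorm_prod, Prod.norm_def, max_le_iff]
    constructor
    · simp only
      rw [norm_neg]
      refine (norm_fderiv_le_of_lipschitz ℝ (lipschitzWith_one_norm)).trans ?_
      rw [NNReal.coe_one]
      exact (one_le_inv₀ hpos).2 hx1.le
    · refine (ContinuousLinearMap.opNorm_comp_le _ _).trans ?_
      rw [Complex.imCLM_norm, one_mul, norm_smul, norm_inv]
      exact mul_le_of_le_one_right (by positivity) ContinuousLinearMap.norm_id_le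

theorem contDiff_coe_circleExp : ContDiff ℝ ∞ fun s : ℝ => (Circle.exp s : ℂ) := by
  simp only [Circle.coe_exp]
  exact (Complex.ofRealCLM.contDiff.mul contDiff_const).cexp

theorem norm_fderiv_coe_circleExp_le (a : ℝ) :
    ‖fderiv ℝ (fun s : ℝ => (Circle.exp s : ℂ)) a‖ ≤ 1 := by
  refine norm_fderiv_le_of_lip' ℝ zero_le_one (Eventually.of_forall fun b => ?_)
  have h1 : (Circle.exp b : ℂ) - Circle.exp a
      = Circle.exp a * (Complex.exp (Complex.I * ((b - a : ℝ) : ℂ)) - 1) := by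
    rw [Circle.coe_exp, Circle.coe_exp, mul_sub, ← Complex.exp_add, mul_one]
    congr 2
    push_cast
    ring
  rw [h1, norm_mul, Circle.norm_coe]
  gcongr
  exact Real.norm_exp_I_mul_ofReal_sub_one_le

theorem extension_contDiffAt_and_norm_fderiv_le {θ : ℝ → ℝ} (hθ : Continuous θ) {d : ℤ}
    (hp : ∀ t, θ (t + 2 * π) = θ t + d * (2 * π)) {x : ℂ} (hx : x ≠ 0) (hx1 : ‖x‖ < 1) :
    ContDiffAt ℝ ∞ (fun y => (extension θ y : ℂ)) x ∧
    ‖fderiv ℝ (fun y => (extension θ y : ℂ)) x‖ ≤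
      ‖fderiv ℝ (fun q : ℝ × ℝ => average θ q.1 q.2) (1 - ‖x‖, Complex.arg x)‖ * ‖x‖⁻¹ := by
  obtain ⟨hT, hT'⟩ := polar_contDiffAt_and_norm_fderiv_le hx hx1
  set T : ℂ → ℝ × ℝ := fun y : ℂ => (1 - ‖y‖, Complex.arg x +
      Complex.arg (y * (Circle.exp (-Complex.arg x) : ℂ))) with hTdef
  have hpos : 0 < ‖x‖ := norm_pos_iff.2 hx
  have hTx : T x = (1 - ‖x‖, Complex.arg x) := by
    simp only [hTdef]
    rw [Circle.exp_neg, Circle.coe_inv, coe_circleExp_arg hx,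
      show x * (x / ‖x‖)⁻¹ = (‖x‖ : ℂ) by field_simp, Complex.arg_ofReal_of_nonneg hpos.le,
      add_zero]
  have heq : (fun y => (extension θ y : ℂ)) =ᶠ[𝓝 x]
      (fun s : ℝ => (Circle.exp s : ℂ)) ∘ (fun q : ℝ × ℝ => average θ q.1 q.2) ∘ T := by
    filter_upwards [isOpen_ne.mem_nhds hx,
      (isOpen_lt continuous_norm continuous_const).mem_nhds hx1] with y hy hy1
    simp only [Function.comp_apply, hTdef]
    rw [extension_eq_rotate hθ hp (Complex.arg x) hy hy1]
  have hA : ContDiffAt ℝ ∞ (fun q : ℝ × ℝ => average θ q.1 q.2) (T x) := by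
    refine (contDiffOn_average hθ).contDiffAt ((isOpen_Ioo.prod isOpen_univ).mem_nhds ?_)
    rw [hTx]
    exact ⟨⟨by simpa using hx1, by simpa using hx⟩, mem_univ _⟩
  have hE := contDiff_coe_circleExp.contDiffAt (x := average θ (T x).1 (T x).2)
  refine ⟨(hE.comp x (hA.comp x hT)).congr_of_eventuallyEq heq, ?_⟩
  rw [heq.fderiv_eq]
  have d1 := (hT.differentiableAt (by simp)).hasFDerivAt
  have d2 := (hA.differentiableAt (by simp)).hasFDerivAt
  have d3 := (hE.differentiableAt (by simp)).hasFDerivAt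
  rw [(d3.comp x (d2.comp x d1)).fderiv, ← hTx]
  refine (ContinuousLinearMap.opNorm_comp_le _ _).trans ?_
  refine (mul_le_of_le_one_left (norm_nonneg _) (norm_fderiv_coe_circleExp_le _)).trans ?_
  refine (ContinuousLinearMap.opNorm_comp_le _ _).trans ?_
  gcongr

theorem tendsto_extension {θ : ℝ → ℝ} (hθ : Continuous θ) (z : Circle) :
    Tendsto (fun r : ℝ => extension θ (r * z)) (𝓝[<] 1)
      (𝓝 (Circle.exp (θ (Complex.arg z)))) := by
  have h1 : Tendsto (fun r : ℝ => 1 - r) (𝓝[<] 1) (𝓝[>] 0) := by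
    refine tendsto_nhdsWithin_iff.2 ⟨?_, ?_⟩
    · refine Tendsto.mono_left ?_ nhdsWithin_le_nhds
      exact (continuous_const.sub continuous_id).tendsto' _ _ (by simp)
    · filter_upwards [self_mem_nhdsWithin] with r hr
      exact sub_pos.2 (mem_Iio.1 hr)
  have h2 := (Circle.exp.continuous.tendsto _).comp
    ((tendsto_average hθ (Complex.arg z)).comp h1)
  refine h2.congr' ?_
  filter_upwards [Ioo_mem_nhdsLT (zero_lt_one' ℝ)] with r hr
  simp only [Function.comp_apply, extension]
  rw [Complex.arg_real_mul _ hr.1, norm_mul, Circle.norm_coe, mul_one, Complex.norm_real,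
    Real.norm_of_nonneg hr.1.le]

/-! ### Domination of the gradient by a potential -/

theorem lintegral_arcLength {f : Circle → ℝ≥0∞} (hf : Measurable f) (t : ℝ) :
    ∫⁻ z, f z ∂arcLength = ∫⁻ s in Ioc (t - π) (t + π), f (Circle.exp s) := by
  rw [arcLength, lintegral_map hf Circle.exp.continuous.measurable]
  have h1 := isAddFundamentalDomain_Ioc Real.two_pi_pos (-π)
  have h2 := isAddFundamentalDomain_Ioc Real.two_pi_pos (t - π)
  rw [show -π + 2 * π = π by ring] at h1
  rw [show t - π + 2 * π = t + π by ring] at h2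
  refine h1.setLIntegral_eq h2 (fun s => f (Circle.exp s)) fun g x => ?_
  obtain ⟨g, k, rfl⟩ := g
  simp only [AddSubgroup.vadd_def, vadd_eq_add]
  congr 1
  refine Circle.exp_eq_exp.2 ⟨k, ?_⟩
  simp
  ring

/-- The gradient of the extension is controlled by a potential of the boundary derivative. -/
theorem exists_enorm_fderiv_extension_le :
    ∃ C : ℝ≥0, ∀ (θ : ℝ → ℝ) (m : Circle → ℂ) (d : ℤ), Continuous θ → Measurable m →
      Integrable m arcLength → (∀ t, θ (t + 2 * π) = θ t + d * (2 * π)) →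
      (∀ a b, a ≤ b → |θ b - θ a| ≤ ∫ s in a..b, π / 2 * ‖m (Circle.exp s)‖) →
      ∀ x : ℂ, x ≠ 0 → ‖x‖ < 1 → ‖fderiv ℝ (fun y => (extension θ y : ℂ)) x‖ₑ ≤
        C * ∫⁻ z, ‖m z‖ₑ * (‖x‖ₑ⁻¹ + ‖x - (z : ℂ)‖ₑ⁻¹) ∂arcLength := by
  obtain ⟨C, hC⟩ := exists_norm_fderiv_average_le
  -- `π / 2` is the arc-chord constant of the lift; 3 comes from `‖x - z‖ ≤ 3h` for the points `z`
  -- of the averaging arc.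
  refine ⟨C * Real.toNNReal (π / 2) * 3, fun θ m d hθ hm hmi hp hb x hx hx1 => ?_⟩
  have hr : 0 < ‖x‖ := norm_pos_iff.2 hx
  set h := 1 - ‖x‖ with hh
  have hh0 : 0 < h := by linarith
  set t := Complex.arg x with ht
  set w := ∫ s in (t - 2 * h)..(t + 2 * h), π / 2 * ‖m (Circle.exp s)‖ with hw
  have hint : ∀ a b, IntervalIntegrable (fun s => π / 2 * ‖m (Circle.exp s)‖) volume a b :=
    fun a b => (intervalIntegrable_comp_circleExp hmi a b).norm.const_mul _
  have hpos : ∀ s, 0 ≤ π / 2 * ‖m (Circle.exp s)‖ := fun s => by positivity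
  have hosc : ∀ s, |s - t| ≤ 2 * h → |θ s - θ t| ≤ w := by
    intro s hs
    obtain ⟨a, b⟩ := abs_le.1 hs
    rcases le_total t s with hts | hts
    · refine (hb _ _ hts).trans ?_
      exact intervalIntegral.integral_mono_interval (by linarith) hts (by linarith)
        (ae_of_all _ hpos) (hint _ _)
    · rw [abs_sub_comm]
      refine (hb _ _ hts).trans ?_
      exact intervalIntegral.integral_mono_interval (by linarith) hts (by linarith)
        (ae_of_all _ hpos) (hint _ _)
  have hmain := (extension_contDiffAt_and_norm_fderiv_le hθ hp hx hx1).2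
  have h1 : ‖fderiv ℝ (fun y => (extension θ y : ℂ)) x‖ ≤ C * w / h * ‖x‖⁻¹ := by
    refine hmain.trans ?_
    gcongr
    exact hC θ hθ h t w hh0 hosc
  have hwe : ENNReal.ofReal w = ENNReal.ofReal (π / 2) *
      ∫⁻ s in Ioc (t - 2 * h) (t + 2 * h), ‖m (Circle.exp s)‖ₑ := by
    rw [hw, intervalIntegral.integral_of_le (by linarith),
      ofReal_integral_eq_lintegral_ofReal (hint _ _).1 (ae_of_all _ hpos),
      ← lintegral_const_mul' _ _ ENNReal.ofReal_ne_top]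
    refine lintegral_congr fun s => ?_
    rw [ENNReal.ofReal_mul (by positivity), ofReal_norm]
  have hker : ∀ s ∈ Ioc (t - 2 * h) (t + 2 * h), ENNReal.ofReal (h⁻¹ * ‖x‖⁻¹) ≤
      3 * (‖x‖ₑ⁻¹ + ‖x - (Circle.exp s : ℂ)‖ₑ⁻¹) := by
    intro s hs
    have hxs : 0 < ‖x - (Circle.exp s : ℂ)‖ := by
      have := norm_sub_norm_le (Circle.exp s : ℂ) x
      rw [Circle.norm_coe, norm_sub_rev] at this
      linarith
    have hst : |t - s| ≤ 2 * h := abs_le.2 ⟨by linarith [hs.2], by linarith [hs.1]⟩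
    have e1 : ‖x - (Circle.exp t : ℂ)‖ = h := by
      rw [ht, coe_circleExp_arg hx,
        show x - x / (‖x‖ : ℂ) = (((‖x‖ - 1) / ‖x‖ : ℝ) : ℂ) * x by
          have : (‖x‖ : ℂ) ≠ 0 := by simpa using hx
          push_cast; field_simp, norm_mul, Complex.norm_real,
        Real.norm_eq_abs, abs_div, abs_of_neg (by linarith : ‖x‖ - 1 < 0), abs_norm]
      field_simp
      rw [hh]; ring
    have e2 : ‖(Circle.exp t : ℂ) - Circle.exp s‖ ≤ 2 * h := by
      have := Convex.norm_image_sub_le_of_norm_fderiv_le (𝕜 := ℝ) (s := univ)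
        (f := fun s : ℝ => (Circle.exp s : ℂ)) (C := 1) (x := s) (y := t)
        (fun y _ => contDiff_coe_circleExp.differentiable (by simp) y)
        (fun y _ => norm_fderiv_coe_circleExp_le y) convex_univ (mem_univ _) (mem_univ _)
      rw [one_mul, Real.norm_eq_abs] at this
      exact this.trans hst
    have e3 : ‖x - (Circle.exp s : ℂ)‖ ≤ 3 * h := by
      have := norm_sub_le_norm_sub_add_norm_sub x (Circle.exp t : ℂ) (Circle.exp s : ℂ)
      linarith
    have e4 : h⁻¹ * ‖x‖⁻¹ ≤ 3 * (‖x‖⁻¹ + ‖x - (Circle.exp s : ℂ)‖⁻¹) := by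
      -- Partial fractions, since `h + ‖x‖ = 1`: this separates the singularity at the origin from
      -- the one at the boundary.
      have f1 : h⁻¹ * ‖x‖⁻¹ = ‖x‖⁻¹ + h⁻¹ := by
        field_simp; rw [hh]; ring
      have f2 : (3 * h)⁻¹ ≤ ‖x - (Circle.exp s : ℂ)‖⁻¹ := inv_anti₀ hxs e3
      rw [mul_inv] at f2
      have f3 : 0 < ‖x‖⁻¹ := by positivity
      rw [f1]
      linarith
    refine (ENNReal.ofReal_le_ofReal e4).trans ?_
    rw [ENNReal.ofReal_mul (by norm_num), ENNReal.ofReal_add (by positivity) (by positivity),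
      ENNReal.ofReal_inv_of_pos hr, ENNReal.ofReal_inv_of_pos hxs, ofReal_norm,
      ofReal_norm]
    simp
  have hmeasK : Measurable fun z : Circle => ‖m z‖ₑ * (‖x‖ₑ⁻¹ + ‖x - (z : ℂ)‖ₑ⁻¹) :=
    hm.enorm.mul (((measurable_circle_coe.const_sub x).enorm.inv).const_add _)
  rw [← ofReal_norm]
  calc ENNReal.ofReal ‖fderiv ℝ (fun y => (extension θ y : ℂ)) x‖
      ≤ ENNReal.ofReal (C * w / h * ‖x‖⁻¹) := ENNReal.ofReal_le_ofReal h1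
    _ = C * (ENNReal.ofReal (π / 2) * (∫⁻ s in Ioc (t - 2 * h) (t + 2 * h),
          ‖m (Circle.exp s)‖ₑ * ENNReal.ofReal (h⁻¹ * ‖x‖⁻¹))) := by
        rw [lintegral_mul_const' _ _ ENNReal.ofReal_ne_top, ← mul_assoc (ENNReal.ofReal (π / 2)),
          ← hwe, ← ENNReal.ofReal_mul' (by positivity), ← ENNReal.ofReal_coe_nnreal,
          ← ENNReal.ofReal_mul C.coe_nonneg]
        congr 1
        field_simp
    _ ≤ C * (ENNReal.ofReal (π / 2) * (∫⁻ s in Ioc (t - π) (t + π),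
          3 * (‖m (Circle.exp s)‖ₑ * (‖x‖ₑ⁻¹ + ‖x - (Circle.exp s : ℂ)‖ₑ⁻¹)))) := by
        gcongr C * (ENNReal.ofReal (π / 2) * ?_)
        refine (setLIntegral_mono' measurableSet_Ioc
          (g := fun s => 3 * (‖m (Circle.exp s)‖ₑ * (‖x‖ₑ⁻¹ + ‖x - (Circle.exp s : ℂ)‖ₑ⁻¹)))
          fun s hs => ?_).trans ?_
        · rw [mul_left_comm]
          gcongr
          exact hker s hs
        -- As `2h < 2 < π`, the interval fits in one period centred at `t`.
        · refine lintegral_mono_set (Ioc_subset_Ioc ?_ ?_) <;> linarith [Real.pi_gt_three]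
    _ = _ := by
        rw [lintegral_const_mul' _ _ (by simp), ← lintegral_arcLength hmeasK t]
        push_cast
        rw [ENNReal.ofReal]
        ring

/-! ### Weak `L²` estimates and uniform integrability -/

theorem lintegral_ball_enorm_inv_le {R : ℝ} (hR : 0 ≤ R) :
    ∫⁻ x in Metric.ball (0 : ℂ) R, ‖x‖ₑ⁻¹ ≤ ENNReal.ofReal (2 * π * R) := by
  rw [← lintegral_indicator Metric.isOpen_ball.measurableSet,
    ← Complex.lintegral_comp_polarCoord_symm]
  calc _ ≤ ∫⁻ p in polarCoord.target, (Ioo 0 R ×ˢ Ioo (-π) π).indicator (1 : ℝ × ℝ → ℝ≥0∞) p := by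
        refine setLIntegral_mono' polarCoord.open_target.measurableSet fun p hp => ?_
        simp only [polarCoord_target, mem_prod, mem_Ioi] at hp
        by_cases h : Complex.polarCoord.symm p ∈ Metric.ball (0 : ℂ) R
        · have hn : ‖Complex.polarCoord.symm p‖ = p.1 := by
            rw [Complex.norm_polarCoord_symm, abs_of_pos hp.1]
          have hpR : p.1 < R := by rwa [mem_ball_zero_iff, hn] at h
          have hmem : p ∈ Ioo 0 R ×ˢ Ioo (-π) π := ⟨⟨hp.1, hpR⟩, hp.2⟩
          rw [indicator_of_mem h, indicator_of_mem hmem,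
            ← ofReal_norm, hn, smul_eq_mul, ENNReal.mul_inv_cancel
              (by simpa using hp.1) ENNReal.ofReal_ne_top]
          rfl
        · rw [indicator_of_notMem h, smul_zero]
          exact zero_le
    _ ≤ ∫⁻ p, (Ioo 0 R ×ˢ Ioo (-π) π).indicator (1 : ℝ × ℝ → ℝ≥0∞) p :=
        setLIntegral_le_lintegral _ _
    _ = ENNReal.ofReal (2 * π * R) := by
        rw [lintegral_indicator_one (measurableSet_Ioo.prod measurableSet_Ioo),
          Measure.volume_eq_prod, Measure.prod_prod, Real.volume_Ioo, Real.volume_Ioo,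
          ← ENNReal.ofReal_mul (by linarith)]
        congr 1
        ring

/-- The kernel `1 / |x - y|` belongs to `L^{(2,∞)}` of the plane, uniformly in `y`. -/
theorem setLIntegral_enorm_sub_inv_le (y : ℂ) (E : Set ℂ) :
    ∫⁻ x in E, ‖x - y‖ₑ⁻¹ ≤ ENNReal.ofReal (2 * π + 1) * volume E ^ (1 / 2 : ℝ) := by
  have hC : ENNReal.ofReal (2 * π + 1) ≠ 0 := by
    rw [Ne, ENNReal.ofReal_eq_zero, not_le]; positivity
  rcases eq_or_ne (volume E) ⊤ with hE | hE
  · rw [hE, ENNReal.top_rpow_of_pos (by norm_num), ENNReal.mul_top hC]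
    exact le_top
  rcases eq_or_ne (volume E) 0 with hE0 | hE0
  · rw [Measure.restrict_eq_zero.2 hE0]
    simp
  set a := (volume E).toReal with ha
  have ha0 : 0 < a := ENNReal.toReal_pos hE0 hE
  -- This radius balances the inner part `2πR` against the outer part `|E| / R`.
  set R := √a with hR
  have hR0 : 0 < R := Real.sqrt_pos.2 ha0
  have hEa : volume E = ENNReal.ofReal a := (ENNReal.ofReal_toReal hE).symm
  have hball : ∫⁻ x in Metric.ball y R, ‖x - y‖ₑ⁻¹ ≤ ENNReal.ofReal (2 * π * R) := by
    refine le_trans (le_of_eq ?_) (lintegral_ball_enorm_inv_le hR0.le)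
    rw [← lintegral_indicator Metric.isOpen_ball.measurableSet,
      ← lintegral_indicator Metric.isOpen_ball.measurableSet,
      ← lintegral_sub_right_eq_self ((Metric.ball (0 : ℂ) R).indicator _) y]
    refine lintegral_congr fun x => ?_
    by_cases hx : x ∈ Metric.ball y R
    · rw [indicator_of_mem hx, indicator_of_mem]
      rwa [mem_ball_zero_iff, ← dist_eq_norm]
    · rw [indicator_of_notMem hx, indicator_of_notMem]
      rwa [mem_ball_zero_iff, ← dist_eq_norm]
  have hout : ∫⁻ x in E \ Metric.ball y R, ‖x - y‖ₑ⁻¹ ≤ ENNReal.ofReal R := by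
    have h1 : ∫⁻ x in E \ Metric.ball y R, ‖x - y‖ₑ⁻¹ ≤
        ∫⁻ _ in E \ Metric.ball y R, (ENNReal.ofReal R)⁻¹ := by
      refine lintegral_mono_ae ?_
      have h2 : ∀ᵐ x ∂volume.restrict (Metric.ball y R)ᶜ, x ∈ (Metric.ball y R)ᶜ :=
        ae_restrict_mem Metric.isOpen_ball.measurableSet.compl
      filter_upwards [ae_restrict_of_ae_restrict_of_subset (sdiff_subset_compl _ _) h2] with x hx
      rw [ENNReal.inv_le_inv, ← ofReal_norm]
      refine ENNReal.ofReal_le_ofReal ?_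
      simpa [dist_eq_norm] using hx
    refine h1.trans ?_
    rw [setLIntegral_const]
    calc (ENNReal.ofReal R)⁻¹ * volume (E \ Metric.ball y R)
        ≤ (ENNReal.ofReal R)⁻¹ * ENNReal.ofReal a := by
          gcongr
          exact (measure_mono sdiff_subset).trans hEa.le
      _ = ENNReal.ofReal R := by
          rw [← ENNReal.ofReal_inv_of_pos hR0, ← ENNReal.ofReal_mul (by positivity)]
          congr 1
          rw [inv_mul_eq_div, div_eq_iff hR0.ne', hR, Real.mul_self_sqrt ha0.le]
  calc ∫⁻ x in E, ‖x - y‖ₑ⁻¹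
      ≤ ∫⁻ x in Metric.ball y R ∪ E \ Metric.ball y R, ‖x - y‖ₑ⁻¹ :=
        lintegral_mono_set (by rw [union_sdiff_self]; exact subset_union_right)
    _ ≤ _ := lintegral_union_le _ _ _
    _ ≤ ENNReal.ofReal (2 * π * R) + ENNReal.ofReal R := add_le_add hball hout
    _ = _ := by
        rw [← ENNReal.ofReal_add (by positivity) hR0.le, hEa,
          ENNReal.ofReal_rpow_of_pos ha0, ← Real.sqrt_eq_rpow,
          ← ENNReal.ofReal_mul (by positivity)]
        congr 1
        ring

/-- The potential of the density `m` on the circle of radius `a`, together with its total mass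
divided by the distance to the origin. -/
def potential (m : Circle → ℂ) (a : ℝ) (x : ℂ) : ℝ≥0∞ :=
  ∫⁻ z, ‖m z‖ₑ * (‖x‖ₑ⁻¹ + ‖x - a * (z : ℂ)‖ₑ⁻¹) ∂arcLength

/-- Tonelli and the kernel bound, used once for each of the two kernels. Uniformity in `a` is what
later controls all dilations of the extension at once. -/
theorem setLIntegral_potential_le {m : Circle → ℂ} (hm : Measurable m) (a : ℝ) (E : Set ℂ) :
    ∫⁻ x in E, potential m a x ≤
      2 * ENNReal.ofReal (2 * π + 1) * (∫⁻ z, ‖m z‖ₑ ∂arcLength) * volume E ^ (1 / 2 : ℝ) := by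
  have hmeas : Measurable fun p : ℂ × Circle =>
      ‖m p.2‖ₑ * (‖p.1‖ₑ⁻¹ + ‖p.1 - a * (p.2 : ℂ)‖ₑ⁻¹) :=
    (hm.comp measurable_snd).enorm.mul (measurable_fst.enorm.inv.add
      ((measurable_fst.sub ((measurable_circle_coe.comp measurable_snd).const_mul _)).enorm.inv))
  simp only [potential]
  rw [lintegral_lintegral_swap hmeas.aemeasurable]
  calc _ ≤ ∫⁻ z, ‖m z‖ₑ * (2 * ENNReal.ofReal (2 * π + 1) * volume E ^ (1 / 2 : ℝ)) ∂arcLength := by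
        refine lintegral_mono fun z => ?_
        rw [lintegral_const_mul' _ _ (by simp), lintegral_add_left (by fun_prop)]
        gcongr
        rw [mul_assoc, two_mul]
        refine add_le_add ?_ (setLIntegral_enorm_sub_inv_le _ E)
        simpa using setLIntegral_enorm_sub_inv_le 0 E
    _ = _ := by
        rw [lintegral_mul_const _ hm.enorm]
        ring

/-- Apply the hypothesis to a superlevel set `E`: `t μ(E) ≤ K μ(E)^{1/2}`, then divide and square.
Bounds over sets, unlike the quasinorm, pass through integrals of kernels with no loss. -/
theorem weakLpNorm_two_le {α F : Type*} [MeasurableSpace α] [NormedAddCommGroup F] {f : α → F}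
    {μ : Measure α} [IsFiniteMeasure μ] {K : ℝ≥0∞} (hf : AEStronglyMeasurable f μ)
    (h : ∀ E, ∫⁻ x in E, ‖f x‖ₑ ∂μ ≤ K * μ E ^ (1 / 2 : ℝ)) : weakLpNorm f 2 μ ≤ K := by
  rw [weakLpNorm, ← ENNReal.rpow_le_rpow_iff (z := 2) (by norm_num), ← ENNReal.rpow_mul,
    one_div_mul_cancel two_ne_zero, ENNReal.rpow_one]
  refine iSup₂_le fun t ht => ?_
  set E := {x | (t : ℝ≥0∞) < ‖f x‖ₑ} with hE
  rcases eq_or_ne (μ E) 0 with h0 | h0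
  · simp [h0]
  have hsq : μ E = μ E ^ (1 / 2 : ℝ) * μ E ^ (1 / 2 : ℝ) := by
    rw [← ENNReal.rpow_add_of_nonneg _ _ (by norm_num) (by norm_num)]
    norm_num
  have h1 : (t : ℝ≥0∞) * μ E ≤ K * μ E ^ (1 / 2 : ℝ) := by
    refine le_trans ?_ (h E)
    rw [← setLIntegral_const]
    refine lintegral_mono_ae ?_
    have hEm : NullMeasurableSet E μ := nullMeasurableSet_lt aemeasurable_const hf.enorm
    filter_upwards [ae_restrict_mem₀ hEm] with x hx using (mem_ofPred.1 hx).le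
  have hne : μ E ^ (1 / 2 : ℝ) ≠ 0 := by simp [ENNReal.rpow_eq_zero_iff, h0]
  have hnt : μ E ^ (1 / 2 : ℝ) ≠ ⊤ := ENNReal.rpow_ne_top_of_nonneg (by norm_num)
    (measure_ne_top _ _)
  have h2 : (t : ℝ≥0∞) * μ E ^ (1 / 2 : ℝ) ≤ K := by
    refine (ENNReal.mul_le_mul_iff_left hne hnt).1 ?_
    rwa [mul_assoc, ← hsq]
  calc (t : ℝ≥0∞) ^ (2 : ℝ) * μ E = ((t : ℝ≥0∞) * μ E ^ (1 / 2 : ℝ)) ^ (2 : ℝ) := by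
        rw [ENNReal.mul_rpow_of_nonneg _ _ (by norm_num), ← ENNReal.rpow_mul]
        norm_num
    _ ≤ K ^ (2 : ℝ) := by gcongr

theorem setLIntegral_enorm_le_of_norm_le_one {α F : Type*} [MeasurableSpace α]
    [NormedAddCommGroup F] {f : α → F} {μ : Measure α} (hf : ∀ᵐ x ∂μ, ‖f x‖ ≤ 1) (E : Set α) :
    ∫⁻ x in E, ‖f x‖ₑ ∂μ ≤ μ univ ^ (1 / 2 : ℝ) * μ E ^ (1 / 2 : ℝ) := by
  calc ∫⁻ x in E, ‖f x‖ₑ ∂μ ≤ ∫⁻ _ in E, 1 ∂μ := by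
        refine lintegral_mono_ae ?_
        filter_upwards [ae_restrict_of_ae hf] with x hx
        rw [← ofReal_norm]
        exact ENNReal.ofReal_le_one.2 hx
    _ = μ E ^ (1 / 2 : ℝ) * μ E ^ (1 / 2 : ℝ) := by
        rw [setLIntegral_one, ← ENNReal.rpow_add_of_nonneg _ _ (by norm_num) (by norm_num)]
        norm_num
    _ ≤ _ := by
        gcongr
        exact subset_univ _

/-- Almost everywhere convergence together with a uniform weak-type bound gives convergence
in `L¹`. -/
theorem tendsto_eLpNorm_one_of_setLIntegral_le {α F : Type*} [MeasurableSpace α]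
    [NormedAddCommGroup F] {f : ℕ → α → F} {g : α → F} {μ : Measure α} [IsFiniteMeasure μ]
    {K : ℝ≥0∞} (hK : K ≠ ⊤) (hf : ∀ n, AEStronglyMeasurable (f n) μ)
    (hg : AEStronglyMeasurable g μ)
    (hfK : ∀ n E, ∫⁻ x in E, ‖f n x‖ₑ ∂μ ≤ K * μ E ^ (1 / 2 : ℝ))
    (hgK : ∫⁻ x, ‖g x‖ₑ ∂μ ≠ ⊤)
    (hfg : ∀ᵐ x ∂μ, Tendsto (fun n => f n x) atTop (𝓝 (g x))) :
    Tendsto (fun n => eLpNorm (fun x => f n x - g x) 1 μ) atTop (𝓝 0) := by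
  refine tendsto_Lp_finite_of_tendsto_ae le_rfl (by simp) hf
    ⟨hg, by rw [eLpNorm_one_eq_lintegral_enorm]; exact hgK.lt_top⟩ ?_ hfg
  intro ε hε
  lift K to ℝ≥0 using hK
  -- Vitali's theorem: on sets this small the integrals are at most `K * (ε / (K + 1)) ≤ ε`; `K + 1`
  -- also covers `K = 0`.
  refine ⟨(ε / (K + 1)) ^ 2, by positivity, fun n s hs hμs => ?_⟩
  rw [eLpNorm_one_eq_lintegral_enorm]
  simp only [enorm_indicator_eq_indicator_enorm]
  rw [lintegral_indicator hs]
  refine (hfK n s).trans ?_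
  calc (K : ℝ≥0∞) * μ s ^ (1 / 2 : ℝ)
      ≤ K * ENNReal.ofReal ((ε / (K + 1)) ^ 2) ^ (1 / 2 : ℝ) := by gcongr
    _ = ENNReal.ofReal (K * (ε / (K + 1))) := by
        rw [ENNReal.ofReal_rpow_of_nonneg (by positivity) (by norm_num), ← Real.sqrt_eq_rpow,
          Real.sqrt_sq (by positivity), ENNReal.ofReal_mul K.coe_nonneg, ENNReal.ofReal_coe_nnreal]
    _ ≤ ENNReal.ofReal ε := by
        refine ENNReal.ofReal_le_ofReal ?_
        rw [mul_div_assoc', div_le_iff₀ (by positivity)]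
        nlinarith

/-! ### Smooth approximation up to the boundary -/

/-- A fixed bump function on the plane. -/
def planeBump : ContDiffBump (0 : ℂ) := ⟨1, 2, by norm_num, by norm_num⟩

/-- A cutoff function equal to one on the closed unit disc. -/
def outerBump (ε : ℝ) (hε : 0 < ε) : ContDiffBump (0 : ℂ) := ⟨1, 1 + ε, one_pos, by linarith⟩

/-- A dilation of `u`, cut off near the origin and outside the disc. -/
def approx (u : ℂ → ℂ) (ε : ℝ) (hε : 0 < ε) (x : ℂ) : ℂ :=
  (outerBump ε hε x * (1 - planeBump (ε⁻¹ • x))) • u ((1 - ε) • x)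

theorem planeBump_eq_zero {ε : ℝ} (hε : 0 < ε) {x : ℂ} (hx : 2 * ε ≤ ‖x‖) :
    planeBump (ε⁻¹ • x) = 0 := by
  refine planeBump.zero_of_le_dist ?_
  rw [dist_zero_right, norm_smul, norm_inv, Real.norm_of_nonneg hε.le, inv_mul_eq_div,
    le_div_iff₀ hε]
  exact hx

theorem planeBump_eq_one {ε : ℝ} (hε : 0 < ε) {x : ℂ} (hx : ‖x‖ ≤ ε) :
    planeBump (ε⁻¹ • x) = 1 := by
  refine planeBump.one_of_mem_closedBall ?_
  rw [mem_closedBall_zero_iff, norm_smul, norm_inv, Real.norm_of_nonneg hε.le, inv_mul_eq_div,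
    div_le_iff₀ hε]
  simpa [planeBump] using hx

theorem contDiff_planeBump_smul (c : ℝ) : ContDiff ℝ ∞ fun x : ℂ => planeBump (c • x) :=
  planeBump.contDiff.comp (contDiff_const_smul c)

theorem approx_eq_of_norm_le_one (u : ℂ → ℂ) {ε : ℝ} (hε : 0 < ε) {x : ℂ} (hx : ‖x‖ ≤ 1) :
    approx u ε hε x = (1 - planeBump (ε⁻¹ • x)) • u ((1 - ε) • x) := by
  rw [approx, (outerBump ε hε).one_of_mem_closedBall (by simpa [outerBump] using hx), one_mul]

theorem approx_eq (u : ℂ → ℂ) {ε : ℝ} (hε : 0 < ε) {x : ℂ} (hx : ‖x‖ ≤ 1) (hx2 : 2 * ε ≤ ‖x‖) :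
    approx u ε hε x = u ((1 - ε) • x) := by
  rw [approx_eq_of_norm_le_one u hε hx, planeBump_eq_zero hε hx2, sub_zero, one_smul]

theorem norm_approx_le_one {u : ℂ → ℂ} (hu : ∀ x, ‖u x‖ ≤ 1) {ε : ℝ} (hε : 0 < ε) {x : ℂ}
    (hx : ‖x‖ ≤ 1) : ‖approx u ε hε x‖ ≤ 1 := by
  rw [approx_eq_of_norm_le_one u hε hx, norm_smul,
    Real.norm_of_nonneg (sub_nonneg.2 planeBump.le_one)]
  exact mul_le_one₀ (by linarith [planeBump.nonneg (x := ε⁻¹ • x)]) (norm_nonneg _) (hu _)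

/-- The inner cutoff removes the possible singularity at the origin. The outer one vanishes beyond
radius `1 + ε`, and `(1 - ε) (1 + ε) < 1` keeps the dilated argument inside the disc until then. -/
theorem contDiff_approx {u : ℂ → ℂ} (hu : ∀ x, x ≠ 0 → ‖x‖ < 1 → ContDiffAt ℝ ∞ u x) {ε : ℝ}
    (hε : 0 < ε) (hε1 : ε < 1) : ContDiff ℝ ∞ (approx u ε hε) := by
  rw [contDiff_iff_contDiffAt]
  intro x
  rcases eq_or_ne x 0 with rfl | hx0
  · refine contDiffAt_const (c := (0 : ℂ)) |>.congr_of_eventuallyEq ?_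
    filter_upwards [Metric.ball_mem_nhds (0 : ℂ) hε] with y hy
    rw [mem_ball_zero_iff] at hy
    rw [approx, planeBump_eq_one hε hy.le, sub_self, mul_zero, zero_smul]
  rcases lt_or_ge ‖(1 - ε) • x‖ 1 with hx1 | hx1
  · refine ContDiffAt.smul (ContDiffAt.mul (outerBump ε hε).contDiffAt
      (contDiffAt_const.sub (contDiff_planeBump_smul _).contDiffAt)) ?_
    exact (hu _ (smul_ne_zero (by linarith) hx0) hx1).comp x (contDiff_const_smul _).contDiffAt
  · refine contDiffAt_const (c := (0 : ℂ)) |>.congr_of_eventuallyEq ?_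
    have hx2 : 1 + ε < ‖x‖ := by
      rw [norm_smul, Real.norm_of_nonneg (by linarith)] at hx1
      by_contra! h
      nlinarith [mul_le_mul_of_nonneg_left h (by linarith : 0 ≤ 1 - ε), mul_pos hε hε]
    filter_upwards [(isOpen_lt continuous_const continuous_norm).mem_nhds hx2] with y hy
    rw [approx, (outerBump ε hε).zero_of_le_dist, zero_mul, zero_smul]
    rw [dist_zero_right]
    exact (le_of_lt hy)

/-- The quantity `‖y‖ ‖∇η(y)‖` is bounded and scale invariant, so every rescaled cutoff has gradient
at most `B / ‖x‖`, uniformly in `c`. -/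
theorem exists_norm_fderiv_planeBump_le :
    ∃ B : ℝ≥0, ∀ (c : ℝ) (x : ℂ), x ≠ 0 → ‖fderiv ℝ (fun y : ℂ => planeBump (c • y)) x‖ₑ ≤
      B * ‖x‖ₑ⁻¹ := by
  have hc : Continuous fun y : ℂ => ‖y‖ • fderiv ℝ planeBump y :=
    continuous_norm.smul (planeBump.contDiff (n := 1) |>.continuous_fderiv (by simp))
  obtain ⟨B, hB⟩ := HasCompactSupport.exists_bound_of_continuous
    (planeBump.hasCompactSupport.fderiv (𝕜 := ℝ) |>.smul_left (f := fun y : ℂ => ‖y‖)) hc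
  refine ⟨B.toNNReal, fun c x hx => ?_⟩
  have hx' : 0 < ‖x‖ := norm_pos_iff.2 hx
  have h1 : ‖fderiv ℝ (fun y : ℂ => planeBump (c • y)) x‖ ≤ B * ‖x‖⁻¹ := by
    rw [fderiv_comp_smul, ← div_eq_mul_inv, le_div_iff₀ hx', norm_smul]
    have : ‖‖c • x‖ • fderiv ℝ planeBump (c • x)‖ ≤ B := hB (c • x)
    rw [norm_smul, norm_norm, norm_smul] at this
    calc _ = _ := by ring
      _ ≤ B := this
  have hB0 : 0 ≤ B := (norm_nonneg _).trans (hB 0)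
  rw [← ofReal_norm, ← ofReal_norm, ← ENNReal.ofReal_inv_of_pos hx',
    show ((B.toNNReal : ℝ≥0) : ℝ≥0∞) = ENNReal.ofReal B from rfl, ← ENNReal.ofReal_mul hB0]
  exact ENNReal.ofReal_le_ofReal h1

/-- Both kernels are homogeneous of degree -1; dilating `x` amounts to moving the density to the
circle of radius `r⁻¹`. -/
theorem potential_smul (m : Circle → ℂ) {r : ℝ} (hr : 0 < r) (x : ℂ) :
    ‖r‖ₑ * potential m 1 (r • x) = potential m r⁻¹ x := by
  rw [potential, potential, ← lintegral_const_mul' _ _ (by simp)]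
  refine lintegral_congr fun z => ?_
  have hr0 : ‖r‖ₑ ≠ 0 := by simpa using hr.ne'
  have key : ∀ y : ℂ, ‖r‖ₑ * ‖r • y‖ₑ⁻¹ = ‖y‖ₑ⁻¹ := fun y => by
    rw [enorm_smul, ENNReal.mul_inv (Or.inl hr0) (Or.inl (by simp)), ← mul_assoc,
      ENNReal.mul_inv_cancel hr0 (by simp), one_mul]
  have h2 : r • x - ((1 : ℝ) : ℂ) * (z : ℂ) = r • (x - ((r⁻¹ : ℝ) : ℂ) * (z : ℂ)) := by
    rw [smul_sub, Complex.real_smul, Complex.real_smul, ← mul_assoc, ← Complex.ofReal_mul,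
      mul_inv_cancel₀ hr.ne']
  rw [mul_left_comm, mul_add, h2, key, key]

theorem exists_enorm_fderiv_approx_le :
    ∃ B : ℝ≥0, ∀ (u : ℂ → ℂ) (m : Circle → ℂ) (C : ℝ≥0), (∀ x, ‖u x‖ ≤ 1) →
      (∀ x, x ≠ 0 → ‖x‖ < 1 → ContDiffAt ℝ ∞ u x) →
      (∀ x, x ≠ 0 → ‖x‖ < 1 → ‖fderiv ℝ u x‖ₑ ≤ C * potential m 1 x) →
      ∀ (ε : ℝ) (hε : 0 < ε), ε < 1 → ∀ x, x ≠ 0 → ‖x‖ < 1 →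
        ‖fderiv ℝ (approx u ε hε) x‖ₑ ≤ B * ‖x‖ₑ⁻¹ + C * potential m (1 - ε)⁻¹ x := by
  obtain ⟨B, hB⟩ := exists_norm_fderiv_planeBump_le
  refine ⟨B, fun u m C hu1 hu hCu ε hε hε1 x hx0 hx1 => ?_⟩
  have heq : approx u ε hε =ᶠ[𝓝 x] fun y => (1 - planeBump (ε⁻¹ • y)) • u ((1 - ε) • y) := by
    filter_upwards [(isOpen_lt continuous_norm continuous_const).mem_nhds hx1] with y hy
    exact approx_eq_of_norm_le_one u hε (le_of_lt hy)
  have hr : 0 < 1 - ε := by linarith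
  have hrx : ‖(1 - ε) • x‖ < 1 := by
    rw [norm_smul, Real.norm_of_nonneg hr.le]
    nlinarith [norm_nonneg x]
  have hrx0 : (1 - ε) • x ≠ 0 := smul_ne_zero hr.ne' hx0
  have d1 : DifferentiableAt ℝ (fun y : ℂ => planeBump (ε⁻¹ • y)) x :=
    (contDiff_planeBump_smul _).contDiffAt.differentiableAt (by simp)
  have d2 : DifferentiableAt ℝ (fun y => u ((1 - ε) • y)) x :=
    ((hu _ hrx0 hrx).comp x (contDiff_const_smul _).contDiffAt).differentiableAt (by simp)
  rw [heq.fderiv_eq, fderiv_fun_smul (d1.const_sub 1) d2, fderiv_const_sub, fderiv_comp_smul,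
    add_comm]
  refine (enorm_add_le _ _).trans (add_le_add ?_ ?_)
  · refine le_trans ?_ (hB ε⁻¹ x hx0)
    rw [← ofReal_norm, ← ofReal_norm, ContinuousLinearMap.norm_smulRight_apply, norm_neg]
    exact ENNReal.ofReal_le_ofReal (mul_le_of_le_one_right (norm_nonneg _) (hu1 _))
  · rw [← potential_smul m hr x, enorm_smul, enorm_smul]
    have h1 : ‖1 - planeBump (ε⁻¹ • x)‖ₑ ≤ 1 := by
      rw [← ofReal_norm, Real.norm_of_nonneg (sub_nonneg.2 planeBump.le_one)]
      exact ENNReal.ofReal_le_one.2 (by linarith [planeBump.nonneg (x := ε⁻¹ • x)])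
    calc _ ≤ 1 * (‖1 - ε‖ₑ * (C * potential m 1 ((1 - ε) • x))) := by
          gcongr
          exact hCu _ hrx0 hrx
      _ = _ := by rw [one_mul, mul_left_comm]

theorem tendsto_one_sub_smul {e : ℕ → ℝ} (he : Tendsto e atTop (𝓝 0)) (x : ℂ) :
    Tendsto (fun k => (1 - e k) • x) atTop (𝓝 x) := by
  simpa using (he.const_sub 1).smul_const x

/-- Near a fixed nonzero point of the disc both cutoffs are eventually inactive and only the
dilation remains. -/
theorem tendsto_approx {u : ℂ → ℂ} (hu : ∀ x, x ≠ 0 → ‖x‖ < 1 → ContDiffAt ℝ ∞ u x)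
    {e : ℕ → ℝ} (he0 : ∀ k, 0 < e k) (he : Tendsto e atTop (𝓝 0)) {x : ℂ}
    (hx : x ≠ 0) (hx1 : ‖x‖ < 1) :
    Tendsto (fun k => approx u (e k) (he0 k) x) atTop (𝓝 (u x)) ∧
    Tendsto (fun k => fderiv ℝ (approx u (e k) (he0 k)) x) atTop (𝓝 (fderiv ℝ u x)) := by
  have hpos : 0 < ‖x‖ := norm_pos_iff.2 hx
  have hsmall : ∀ᶠ k in atTop, 2 * e k < ‖x‖ := by
    have : Tendsto (fun k => 2 * e k) atTop (𝓝 0) := by simpa using he.const_mul 2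
    exact this.eventually_lt_const hpos
  have hlim := tendsto_one_sub_smul he x
  constructor
  · refine Tendsto.congr' ?_ ((hu x hx hx1).continuousAt.tendsto.comp hlim)
    filter_upwards [hsmall] with k hk
    exact (approx_eq u (he0 k) hx1.le hk.le).symm
  · have hc : ContinuousAt (fderiv ℝ u) x :=
      ((hu x hx hx1).fderiv_right (m := 0) (by simp)).continuousAt
    have h1 : Tendsto (fun k => (1 - e k) • fderiv ℝ u ((1 - e k) • x)) atTop
        (𝓝 ((1 - 0 : ℝ) • fderiv ℝ u x)) := (he.const_sub 1).smul (hc.tendsto.comp hlim)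
    rw [sub_zero, one_smul] at h1
    refine h1.congr' ?_
    filter_upwards [hsmall] with k hk
    rw [← fderiv_comp_smul]
    refine (EventuallyEq.fderiv_eq ?_).symm
    filter_upwards [(isOpen_lt continuous_norm continuous_const).mem_nhds hx1,
      (isOpen_lt continuous_const continuous_norm).mem_nhds hk] with y hy hy2
    exact approx_eq u (he0 k) (le_of_lt hy) (le_of_lt hy2)

theorem ae_disc : ∀ᵐ x ∂volume.restrict disc, x ≠ 0 ∧ ‖x‖ < 1 := by
  have h1 : ∀ᵐ x ∂volume.restrict disc, x ∈ disc :=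
    ae_restrict_mem Metric.isOpen_ball.measurableSet
  have h2 : ∀ᵐ x ∂volume.restrict disc, x ≠ (0 : ℂ) := ae_restrict_of_ae (Measure.ae_ne volume 0)
  filter_upwards [h1, h2] with x hx hx0 using ⟨hx0, mem_ball_zero_iff.1 hx⟩

instance : IsFiniteMeasure (volume.restrict disc) :=
  ⟨by rw [Measure.restrict_apply_univ]; exact measure_ball_lt_top⟩

theorem setLIntegral_disc_le {F : Type*} [NormedAddCommGroup F] {f : ℂ → F} {m : Circle → ℂ}
    (hm : Measurable m) {A C : ℝ≥0} {a : ℝ}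
    (hf : ∀ x, x ≠ 0 → ‖x‖ < 1 → ‖f x‖ₑ ≤ A * ‖x‖ₑ⁻¹ + C * potential m a x) (E : Set ℂ) :
    ∫⁻ x in E, ‖f x‖ₑ ∂volume.restrict disc ≤ ENNReal.ofReal (2 * π + 1) *
      (A + 2 * C * ∫⁻ z, ‖m z‖ₑ ∂arcLength) * (volume.restrict disc) E ^ (1 / 2 : ℝ) := by
  have hd : MeasurableSet disc := Metric.isOpen_ball.measurableSet
  have h1 := ae_restrict_of_ae (s := E) ae_disc
  rw [Measure.restrict_restrict' hd] at h1 ⊢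
  rw [Measure.restrict_apply' hd]
  calc _ ≤ ∫⁻ x in E ∩ disc, (A * ‖x‖ₑ⁻¹ + C * potential m a x) := by
        refine lintegral_mono_ae ?_
        filter_upwards [h1] with x hx using hf x hx.1 hx.2
    _ = A * (∫⁻ x in E ∩ disc, ‖x‖ₑ⁻¹) + C * ∫⁻ x in E ∩ disc, potential m a x := by
        rw [lintegral_add_left (by fun_prop), lintegral_const_mul' _ _ (by simp),
          lintegral_const_mul' _ _ (by simp)]
    _ ≤ A * (ENNReal.ofReal (2 * π + 1) * volume (E ∩ disc) ^ (1 / 2 : ℝ)) +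
        C * (2 * ENNReal.ofReal (2 * π + 1) * (∫⁻ z, ‖m z‖ₑ ∂arcLength) *
          volume (E ∩ disc) ^ (1 / 2 : ℝ)) := by
        gcongr
        · simpa using setLIntegral_enorm_sub_inv_le 0 (E ∩ disc)
        · exact setLIntegral_potential_le hm a (E ∩ disc)
    _ = _ := by ring

/-- A map of the disc, smooth away from the origin, whose differential is bounded by a potential
of a boundary density, is a limit of smooth functions up to the boundary. -/
theorem exists_smooth_approximation {u : ℂ → ℂ} {m : Circle → ℂ} {C : ℝ≥0} {φ : Circle → ℂ}
    (hm : Measurable m) (hmi : ∫⁻ z, ‖m z‖ₑ ∂arcLength ≠ ⊤) (hu1 : ∀ x, ‖u x‖ ≤ 1)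
    (hu : ∀ x, x ≠ 0 → ‖x‖ < 1 → ContDiffAt ℝ ∞ u x)
    (hCu : ∀ x, x ≠ 0 → ‖x‖ < 1 → ‖fderiv ℝ u x‖ₑ ≤ C * potential m 1 x)
    (hφ : AEStronglyMeasurable φ arcLength)
    (hb : ∀ᵐ z : Circle ∂arcLength,
      Tendsto (fun r : ℝ => u (r * z)) (𝓝[<] 1) (𝓝 (φ z))) :
    Integrable u (volume.restrict disc) ∧ Integrable (fderiv ℝ u) (volume.restrict disc) ∧
    ∃ w : ℕ → ℂ → ℂ, (∀ k, ContDiff ℝ ∞ (w k)) ∧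
      Tendsto (fun k => eLpNorm (fun x => w k x - u x) 1 (volume.restrict disc)) atTop (𝓝 0) ∧
      Tendsto (fun k => eLpNorm (fun x => fderiv ℝ (w k) x - fderiv ℝ u x) 1
        (volume.restrict disc)) atTop (𝓝 0) ∧
      Tendsto (fun k => eLpNorm (fun z : Circle => w k (z : ℂ) - φ z) 1 arcLength)
        atTop (𝓝 0) := by
  obtain ⟨B, hB⟩ := exists_enorm_fderiv_approx_le
  -- The shift by 2 gives `2 * e k ≤ 1`, so the inner cutoff is inactive on the unit circle.
  set e : ℕ → ℝ := fun k => 1 / ((k : ℝ) + 1 + 1) with he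
  have he0 : ∀ k, 0 < e k := fun k => by positivity
  have he2 : ∀ k, e k ≤ 1 / 2 := fun k => by
    simp only [he]
    gcongr
    linarith [(Nat.cast_nonneg k : (0 : ℝ) ≤ k)]
  have het : Tendsto e atTop (𝓝 0) := by
    have := (tendsto_one_div_add_atTop_nhds_zero_nat (𝕜 := ℝ)).comp (tendsto_add_atTop_nat 1)
    refine this.congr fun k => ?_
    simp [he]
  set w : ℕ → ℂ → ℂ := fun k => approx u (e k) (he0 k) with hw
  have hws : ∀ k, ContDiff ℝ ∞ (w k) := fun k =>
    contDiff_approx hu (he0 k) (by linarith [he2 k])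
  have hwm : ∀ k, AEStronglyMeasurable (w k) (volume.restrict disc) := fun k =>
    (hws k).continuous.aestronglyMeasurable
  have hdm : ∀ k, AEStronglyMeasurable (fderiv ℝ (w k)) (volume.restrict disc) := fun k =>
    ((hws k).continuous_fderiv (by simp)).aestronglyMeasurable
  have hwt : ∀ᵐ x ∂volume.restrict disc, Tendsto (fun k => w k x) atTop (𝓝 (u x)) := by
    filter_upwards [ae_disc] with x hx using (tendsto_approx hu he0 het hx.1 hx.2).1
  have hdt : ∀ᵐ x ∂volume.restrict disc,
      Tendsto (fun k => fderiv ℝ (w k) x) atTop (𝓝 (fderiv ℝ u x)) := by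
    filter_upwards [ae_disc] with x hx using (tendsto_approx hu he0 het hx.1 hx.2).2
  have hum : AEStronglyMeasurable u (volume.restrict disc) :=
    aestronglyMeasurable_of_tendsto_ae atTop hwm hwt
  have hDum : AEStronglyMeasurable (fderiv ℝ u) (volume.restrict disc) :=
    aestronglyMeasurable_of_tendsto_ae atTop hdm hdt
  have hsqrt : ∀ E : Set ℂ, (volume.restrict disc) E ^ (1 / 2 : ℝ) ≠ ⊤ := fun E =>
    ENNReal.rpow_ne_top_of_nonneg (by norm_num) (measure_ne_top _ _)
  have hui : ∫⁻ x, ‖u x‖ₑ ∂volume.restrict disc ≠ ⊤ := by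
    have := setLIntegral_enorm_le_of_norm_le_one (μ := volume.restrict disc)
      (ae_of_all _ hu1) univ
    rw [Measure.restrict_univ] at this
    exact ne_top_of_le_ne_top (ENNReal.mul_ne_top (hsqrt _) (hsqrt _)) this
  have hKfin : ∀ A : ℝ≥0, ENNReal.ofReal (2 * π + 1) *
      (A + 2 * C * ∫⁻ z, ‖m z‖ₑ ∂arcLength) ≠ ⊤ := fun A =>
    ENNReal.mul_ne_top ENNReal.ofReal_ne_top (ENNReal.add_ne_top.2 ⟨ENNReal.coe_ne_top,
      ENNReal.mul_ne_top (ENNReal.mul_ne_top (by simp) ENNReal.coe_ne_top) hmi⟩)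
  have hDui : ∫⁻ x, ‖fderiv ℝ u x‖ₑ ∂volume.restrict disc ≠ ⊤ := by
    have := setLIntegral_disc_le hm (A := 0) (C := C) (a := 1) (f := fderiv ℝ u)
      (fun x h0 h1 => by simpa using hCu x h0 h1) univ
    rw [Measure.restrict_univ] at this
    exact ne_top_of_le_ne_top (ENNReal.mul_ne_top (hKfin 0) (hsqrt _)) this
  refine ⟨⟨hum, hui.lt_top⟩, ⟨hDum, hDui.lt_top⟩, w, hws, ?_, ?_, ?_⟩
  · refine tendsto_eLpNorm_one_of_setLIntegral_le (hsqrt univ) hwm hum (fun k E => ?_) hui hwt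
    refine setLIntegral_enorm_le_of_norm_le_one ?_ E
    filter_upwards [ae_disc] with x hx using norm_approx_le_one hu1 (he0 k) hx.2.le
  · exact tendsto_eLpNorm_one_of_setLIntegral_le (hKfin B) hdm hDum
      (fun k E => setLIntegral_disc_le hm
        (hB u m C hu1 hu hCu (e k) (he0 k) (by linarith [he2 k])) E) hDui hdt
  -- On the circle `w k` is `u` at radius `1 - e k`, so boundary convergence is the radial limit
  -- together with the uniform bound 1.
  · have hbt : ∀ᵐ z : Circle ∂arcLength, Tendsto (fun k => w k z) atTop (𝓝 (φ z)) := by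
      filter_upwards [hb] with z hz
      have h1 : Tendsto (fun k => 1 - e k) atTop (𝓝[<] 1) := by
        refine tendsto_nhdsWithin_iff.2 ⟨by simpa using het.const_sub 1, ?_⟩
        exact Eventually.of_forall fun k => mem_Iio.2 (by linarith [he0 k])
      refine (hz.comp h1).congr fun k => ?_
      have hz1 : ‖(z : ℂ)‖ = 1 := Circle.norm_coe z
      have h2 : w k z = u ((1 - e k) • (z : ℂ)) :=
        approx_eq u (he0 k) hz1.le (by rw [hz1]; linarith [he2 k])
      rw [Complex.real_smul] at h2
      exact h2.symm
    have hwK : ∀ k E, ∫⁻ z in E, ‖w k (z : Circle)‖ₑ ∂arcLength ≤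
        arcLength univ ^ (1 / 2 : ℝ) * arcLength E ^ (1 / 2 : ℝ) := fun k E =>
      setLIntegral_enorm_le_of_norm_le_one
        (ae_of_all _ fun z => norm_approx_le_one hu1 (he0 k) (Circle.norm_coe z).le) E
    have hφi : ∫⁻ z, ‖φ z‖ₑ ∂arcLength ≠ ⊤ := by
      have h1 : ∀ᵐ z ∂arcLength, ‖φ z‖ ≤ 1 := by
        filter_upwards [hbt] with z hz
        exact le_of_tendsto hz.norm (Eventually.of_forall fun k =>
          norm_approx_le_one hu1 (he0 k) (Circle.norm_coe z).le)
      have := setLIntegral_enorm_le_of_norm_le_one h1 univ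
      rw [Measure.restrict_univ] at this
      exact ne_top_of_le_ne_top (ENNReal.mul_ne_top
        (ENNReal.rpow_ne_top_of_nonneg (by norm_num) (measure_ne_top _ _))
        (ENNReal.rpow_ne_top_of_nonneg (by norm_num) (measure_ne_top _ _))) this
    exact tendsto_eLpNorm_one_of_setLIntegral_le
      (ENNReal.rpow_ne_top_of_nonneg (by norm_num) (measure_ne_top _ _))
      (fun k => ((hws k).continuous.measurable.comp measurable_circle_coe).aestronglyMeasurable)
      hφ hwK hφi hbt

/-! ### Weak differentiability and the norm bound -/

theorem tendsto_integral_smul {α F : Type*} [MeasurableSpace α] [NormedAddCommGroup F]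
    [NormedSpace ℝ F] {μ : Measure α} {f : ℕ → α → F} {g : α → F} {a : α → ℝ} {c : ℝ≥0}
    (ha : AEStronglyMeasurable a μ) (hac : ∀ x, ‖a x‖ ≤ c) (L : F →L[ℝ] ℂ)
    (hf : ∀ k, AEStronglyMeasurable (f k) μ) (hg : Integrable g μ)
    (hfg : Tendsto (fun k => eLpNorm (fun x => f k x - g x) 1 μ) atTop (𝓝 0)) :
    Tendsto (fun k => ∫ x, a x • L (f k x) ∂μ) atTop (𝓝 (∫ x, a x • L (g x) ∂μ)) := by
  have hint : ∀ {h : α → F}, Integrable h μ → Integrable (fun x => a x • L (h x)) μ := fun hh =>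
    (L.integrable_comp hh).bdd_smul c ha (ae_of_all _ hac)
  have hfi : ∀ᶠ k in atTop, Integrable (f k) μ := by
    filter_upwards [hfg.eventually_lt_const one_pos] with k hk
    have h1 : Integrable (fun x => f k x - g x) μ :=
      memLp_one_iff_integrable.1 ⟨(hf k).sub hg.aestronglyMeasurable, hk.trans ENNReal.one_lt_top⟩
    exact (h1.add hg).congr (ae_of_all _ fun x => by simp)
  refine tendsto_integral_of_L1' _ (hint hg).aestronglyMeasurable (hfi.mono fun k hk => hint hk) ?_
  have hlim : Tendsto (fun k => ENNReal.ofReal (c * ‖L‖) *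
      eLpNorm (fun x => f k x - g x) 1 μ) atTop (𝓝 0) := by
    simpa only [mul_zero] using ENNReal.Tendsto.const_mul hfg (Or.inr ENNReal.ofReal_ne_top)
  refine tendsto_of_tendsto_of_tendsto_of_le_of_le tendsto_const_nhds hlim (fun _ => zero_le)
    fun k => ?_
  refine eLpNorm_le_mul_eLpNorm_of_ae_le_mul (ae_of_all _ fun x => ?_) 1
  rw [Pi.sub_apply, ← smul_sub, ← map_sub, norm_smul, mul_assoc]
  exact mul_le_mul (hac x) (L.le_opNorm _) (norm_nonneg _) c.coe_nonneg

/-- Weak differentiability passes to limits of smooth functions. -/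
theorem hasWeakFDeriv_of_tendsto {u : ℂ → ℂ} {Du : ℂ → ℂ →L[ℝ] ℂ} {w : ℕ → ℂ → ℂ}
    (hu : Integrable u (volume.restrict disc)) (hDu : Integrable Du (volume.restrict disc))
    (hw : ∀ k, ContDiff ℝ ∞ (w k))
    (h0 : Tendsto (fun k => eLpNorm (fun x => w k x - u x) 1 (volume.restrict disc)) atTop (𝓝 0))
    (h1 : Tendsto (fun k => eLpNorm (fun x => fderiv ℝ (w k) x - Du x) 1
        (volume.restrict disc)) atTop (𝓝 0)) : HasWeakFDeriv disc u Du where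
  locallyIntegrable := IntegrableOn.locallyIntegrableOn hu
  locallyIntegrable_fderiv := IntegrableOn.locallyIntegrableOn hDu
  integral_eq η hη hηc hηs v := by
    have hη'c : Continuous fun x => fderiv ℝ η x v :=
      (hη.continuous_fderiv (by simp)).clm_apply continuous_const
    have hη's : HasCompactSupport fun x => fderiv ℝ η x v := hηc.fderiv_apply (𝕜 := ℝ) v
    obtain ⟨c1, hc1⟩ := hη's.exists_bound_of_continuous hη'c
    obtain ⟨c2, hc2⟩ := hηc.exists_bound_of_continuous hη.continuous
    have t1 := tendsto_integral_smul (c := c1.toNNReal) hη'c.aestronglyMeasurable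
      (fun x => (hc1 x).trans (Real.le_coe_toNNReal _)) (ContinuousLinearMap.id ℝ ℂ)
      (fun k => (hw k).continuous.aestronglyMeasurable) hu h0
    have t2 := tendsto_integral_smul (c := c2.toNNReal) hη.continuous.aestronglyMeasurable
      (fun x => (hc2 x).trans (Real.le_coe_toNNReal _)) (ContinuousLinearMap.apply ℝ ℂ v)
      (fun k => ((hw k).continuous_fderiv (by simp)).aestronglyMeasurable) hDu h1
    simp only [ContinuousLinearMap.id_apply, ContinuousLinearMap.apply_apply] at t1 t2
    -- Each `w k` is smooth across the origin, so it satisfies the identity classically; both sides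
    -- converge.
    refine tendsto_nhds_unique t1 (t2.neg.congr fun k => ?_)
    have hwc := (hw k).continuous
    have hw'c : Continuous fun x => fderiv ℝ (w k) x v :=
      ((hw k).continuous_fderiv (by simp)).clm_apply continuous_const
    rw [setIntegral_eq_integral_of_forall_compl_eq_zero fun x hx => by
        rw [image_eq_zero_of_notMem_tsupport fun h => hx (hηs h), zero_smul],
      setIntegral_eq_integral_of_forall_compl_eq_zero fun x hx => by
        rw [fderiv_of_notMem_tsupport ℝ fun h => hx (hηs h), zero_apply, zero_smul],
      neg_eq_iff_eq_neg]
    exact integral_smul_fderiv_eq_neg_fderiv_smul_of_integrable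
      ((hη'c.smul hwc).integrable_of_hasCompactSupport hη's.smul_right)
      ((hη.continuous.smul hw'c).integrable_of_hasCompactSupport hηc.smul_right)
      ((hη.continuous.smul hwc).integrable_of_hasCompactSupport hηc.smul_right)
      (fun x _ => hη.differentiable (by simp) x) (fun x _ => (hw k).differentiable (by simp) x)

theorem gradNorm_le (L : ℂ →L[ℝ] ℂ) : ‖gradNorm L‖ ≤ 2 * ‖L‖ := by
  have h1 : ‖L 1‖ ≤ ‖L‖ := by simpa using L.le_opNorm 1
  have h2 : ‖L Complex.I‖ ≤ ‖L‖ := by simpa using L.le_opNorm Complex.I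
  rw [gradNorm, Real.norm_of_nonneg (Real.sqrt_nonneg _)]
  refine Real.sqrt_le_iff.2 ⟨by positivity, ?_⟩
  nlinarith [norm_nonneg (L 1), norm_nonneg (L Complex.I), norm_nonneg L]

theorem normW12Weak_le {u : ℂ → ℂ} {m : Circle → ℂ} {C : ℝ≥0} (hm : Measurable m)
    (hu1 : ∀ x, ‖u x‖ ≤ 1) (hu : HasWeakFDeriv disc u (fderiv ℝ u))
    (hui : Integrable u (volume.restrict disc))
    (hDui : Integrable (fderiv ℝ u) (volume.restrict disc))
    (hCu : ∀ x, x ≠ 0 → ‖x‖ < 1 → ‖fderiv ℝ u x‖ₑ ≤ C * potential m 1 x) :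
    normW12Weak u ≤ volume disc ^ (1 / 2 : ℝ) +
      ENNReal.ofReal (2 * π + 1) * (2 * (2 * C) * ∫⁻ z, ‖m z‖ₑ ∂arcLength) := by
  refine (iInf₂_le _ hu).trans (add_le_add ?_ ?_)
  · refine weakLpNorm_two_le hui.aestronglyMeasurable fun E => ?_
    simpa using setLIntegral_enorm_le_of_norm_le_one (μ := volume.restrict disc)
      (ae_of_all _ hu1) E
  · have hgc : Continuous gradNorm := by
      unfold gradNorm
      fun_prop
    refine weakLpNorm_two_le (hgc.comp_aestronglyMeasurable hDui.aestronglyMeasurable) fun E => ?_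
    -- The factor 2 in `2 * C` compares `gradNorm` with the operator norm.
    have h := setLIntegral_disc_le hm (A := 0) (C := 2 * C) (a := 1)
      (f := fun x => gradNorm (fderiv ℝ u x)) (fun x h0 h1 => ?_) E
    · simpa using h
    · calc ‖gradNorm (fderiv ℝ u x)‖ₑ ≤ 2 * ‖fderiv ℝ u x‖ₑ := by
            rw [← ofReal_norm, ← ofReal_norm]
            refine (ENNReal.ofReal_le_ofReal (gradNorm_le _)).trans ?_
            rw [ENNReal.ofReal_mul (by norm_num)]
            simp
        _ ≤ 2 * (C * potential m 1 x) := by gcongr; exact hCu x h0 h1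
        _ = _ := by push_cast; simp [mul_assoc]

theorem HasWeakAngularDeriv.congr {φ φ' ψ : Circle → ℂ} (h : HasWeakAngularDeriv φ φ')
    (hψ : φ' =ᵐ[arcLength] ψ) : HasWeakAngularDeriv φ ψ where
  integrable := h.integrable
  integrable_deriv := h.integrable_deriv.congr hψ
  integral_eq η hη := by
    rw [h.integral_eq η hη]
    congr 1
    refine integral_congr_ae ?_
    filter_upwards [hψ] with z hz
    rw [hz]

end

end CircleExtension

/-! ### Conclusion -/

theorem mainTheorem6 :
    ∃ g : ℝ≥0 → ℝ≥0, ∀ φ : Circle → Circle, CircleExtension.MemW11 φ →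
      ∃ u : ℂ → Circle, CircleExtension.MemW12Weak u ∧
        CircleExtension.HasTrace (fun x => (u x : ℂ)) (fun z => (φ z : ℂ)) ∧
        CircleExtension.normW12Weak (fun x => (u x : ℂ)) ≤
          (g (CircleExtension.normW11 (fun z => (φ z : ℂ))).toNNReal : ℝ≥0∞) := by
  open CircleExtension in
  obtain ⟨C, hC⟩ := exists_enorm_fderiv_extension_le
  refine ⟨fun x => (volume disc ^ (1 / 2 : ℝ)).toNNReal +
    Real.toNNReal (2 * Real.pi + 1) * (2 * (2 * C) * (x + 1)), fun φ hφ => ?_⟩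
  set N := normW11 (fun z => (φ z : ℂ)) with hN
  have hNtop : N ≠ ⊤ := hφ.ne
  -- The norm is an infimum, so a derivative is chosen within 1 of it; hence the `x + 1` in `g`.
  obtain ⟨φ₀, hφ₀⟩ := iInf_lt_iff.1 (ENNReal.lt_add_right hNtop one_ne_zero)
  obtain ⟨h₀, hlt⟩ := iInf_lt_iff.1 hφ₀
  -- A genuinely measurable representative, as required for Tonelli in the potential estimate.
  set m : Circle → ℂ := h₀.integrable_deriv.aestronglyMeasurable.mk φ₀ with hmdef
  have hm : Measurable m := h₀.integrable_deriv.aestronglyMeasurable.stronglyMeasurable_mk.measurable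
  have hae : φ₀ =ᵐ[arcLength] m := h₀.integrable_deriv.aestronglyMeasurable.ae_eq_mk
  have h := h₀.congr hae
  have hM : ∫⁻ z, ‖m z‖ₑ ∂arcLength ≤ N + 1 := by
    rw [← eLpNorm_one_eq_lintegral_enorm, ← eLpNorm_congr_ae hae]
    exact le_add_self.trans hlt.le
  obtain ⟨θ, hθ, ⟨d, hd⟩, hlift, hosc⟩ := h.exists_lift
  have hu1 : ∀ x, ‖(extension θ x : ℂ)‖ ≤ 1 := fun x => (Circle.norm_coe _).le
  have hCu : ∀ x : ℂ, x ≠ 0 → ‖x‖ < 1 →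
      ‖fderiv ℝ (fun y => (extension θ y : ℂ)) x‖ₑ ≤ C * potential m 1 x := fun x h0 h1 => by
    simpa [potential] using hC θ m d hθ hm h.integrable_deriv hd hosc x h0 h1
  have hb : ∀ᵐ z : Circle ∂arcLength,
      Tendsto (fun r : ℝ => (extension θ (r * z) : ℂ)) (𝓝[<] 1) (𝓝 (φ z : ℂ)) := by
    filter_upwards [hlift] with z hz
    rw [hz]
    exact (continuous_subtype_val.tendsto _).comp (tendsto_extension hθ z)
  obtain ⟨hui, hDui, w, hw, t0, t1, t2⟩ := exists_smooth_approximation hm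
    (ne_top_of_le_ne_top (by simp [hNtop]) hM) hu1
    (fun x h0 h1 => (extension_contDiffAt_and_norm_fderiv_le hθ hd h0 h1).1) hCu
    h.integrable.aestronglyMeasurable hb
  have hweak := hasWeakFDeriv_of_tendsto hui hDui hw t0 t1
  have hbound : normW12Weak (fun x => (extension θ x : ℂ)) ≤
      (((volume disc ^ (1 / 2 : ℝ)).toNNReal +
        Real.toNNReal (2 * Real.pi + 1) * (2 * (2 * C) * (N.toNNReal + 1)) : ℝ≥0) : ℝ≥0∞) := by
    refine (normW12Weak_le hm hu1 hweak hui hDui hCu).trans ?_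
    have hdisc : volume disc ^ (1 / 2 : ℝ) ≠ ⊤ :=
      ENNReal.rpow_ne_top_of_nonneg (by norm_num) measure_ball_lt_top.ne
    push_cast
    rw [ENNReal.coe_toNNReal hdisc, ENNReal.coe_toNNReal hNtop]
    gcongr
    exact le_rfl
  exact ⟨extension θ, hbound.trans_lt ENNReal.coe_lt_top, ⟨_, hweak, w, hw, t0, t1, t2⟩, hbound⟩
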